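/- Let $d \ge 2$, let $X$ be a standard Borel space, and let $a\colon \mathbb{Z}^d \curvearrowright X$ be a free Borel action, i.e. each $\gamma\in\mathbb{Z}^d$ acts by a Borel map $X\to X$, and $\gamma\cdot x = x$ for some $x\in X$ only if $\gamma=0$. Let $G_a$ be the graph with vertex set $X$ in which $x$ and $y$ are joined by an edge if and only if $y=\gamma\cdot x$ for some $\gamma\in\mathbb{Z}^d$ with $|\gamma|_\infty = 1$, and let $N(x)$ denote the (finite) set of neighbors of $x$ in $G_a$. For $f\colon X\to\mathbb{Z}$, an $f$-flow on $G_a$ is a real-valued function $\phi$ on the set $E=\{(x,y)\in X\times X : y\in N(x)\}$ of oriented edges such that $\phi(x,y)=-\phi(y,x)$ for every $(x,y)\in E$ and $f(x)=\sum_{y\in N(x)}\phi(x,y)$ for every $x\in X$. The flow is Borel if it is a Borel function on $E\subset X\times X$, and integral if all of its values are integers. Then for every Borel function $f\colon X\to\mathbb{Z}$ and every Borel $f$-flow $\phi$ on $G_a$, there is an integral Borel $f$-flow $\psi$ on $G_a$ such that $|\phi(x,y)-\psi(x,y)|\le 3^d$ for every edge $(x,y)$ of $G_a$. -/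

import Mathlib

namespace BorelFlow

/-- An action of `ℤ^d` on `X` is free if no nonzero element of `ℤ^d` fixes a point. -/
def IsFreeAction (d : ℕ) (X : Type*) [AddAction (Fin d → ℤ) X] : Prop :=
  ∀ (γ : Fin d → ℤ) (x : X), γ +ᵥ x = x → γ = 0

/-- The graph `G_a` of an action `a` of `ℤ^d` on `X`: distinct points `x` and `y` are joined when
`y = γ · x` for some `γ` of sup norm `1`. (The norm on `Fin d → ℤ` is the sup norm. For a free
action the condition `x ≠ y` is automatic.) -/
def actionGraph (d : ℕ) (X : Type*) [AddAction (Fin d → ℤ) X] : SimpleGraph X where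
  Adj x y := x ≠ y ∧ ∃ γ : Fin d → ℤ, ‖γ‖ = 1 ∧ γ +ᵥ x = y
  symm := ⟨by
    rintro x y ⟨hne, γ, hγ, rfl⟩
    exact ⟨hne.symm, -γ, by rw [norm_neg, hγ], neg_vadd_vadd γ x⟩⟩
  loopless := ⟨fun _ h => h.1 rfl⟩

theorem finite_norm_eq_one (d : ℕ) : {γ : Fin d → ℤ | ‖γ‖ = 1}.Finite := by
  refine (Set.Finite.pi' (t := fun _ : Fin d => Set.Icc (-1 : ℤ) 1)
    (fun _ => Set.finite_Icc _ _)).subset ?_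
  intro γ hγ i
  have h1 : ‖γ i‖ ≤ 1 := (norm_le_pi_norm γ i).trans (le_of_eq hγ)
  rw [Int.norm_eq_abs] at h1
  have h2 : |γ i| ≤ 1 := by exact_mod_cast h1
  exact abs_le.mp h2

noncomputable instance actionGraphLocallyFinite (d : ℕ) (X : Type*)
    [AddAction (Fin d → ℤ) X] : (actionGraph d X).LocallyFinite := fun x =>
  (((finite_norm_eq_one d).image (fun γ => γ +ᵥ x)).subset
    (fun _ hy => hy.2)).fintype

/-- An `f`-flow on a locally finite graph `G`: a real-valued function on the (oriented) edges
`(x, y)` of `G` with `φ (x, y) = - φ (y, x)` and `f x = ∑ y ∈ N(x), φ (x, y)` for every `x`. -/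
structure IsFlow {V : Type*} (G : SimpleGraph V) [G.LocallyFinite] (f : V → ℝ)
    (φ : G.Dart → ℝ) : Prop where
  antisymm : ∀ e : G.Dart, φ e = - φ e.symm
  sum_eq : ∀ x : V, f x = ∑ y : G.neighborSet x, φ (G.dartOfNeighborSet x y)

/-- A function on the edges is integral if it takes integer values. -/
def IsIntegral {V : Type*} (G : SimpleGraph V) (φ : G.Dart → ℝ) : Prop :=
  ∀ e : G.Dart, ∃ n : ℤ, φ e = n

/-- The Borel structure on the set of oriented edges, as a subset of `X × X`. -/
instance dartMeasurableSpace {X : Type*} [MeasurableSpace X] (G : SimpleGraph X) :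
    MeasurableSpace G.Dart :=
  MeasurableSpace.comap (fun e : G.Dart => e.toProd) inferInstance

end BorelFlow

/-! On a finite graph, a real flow with integer divergence is rounded by pushing along circulations
supported on the non-integral edges (`exists_rounding`). The action graph is infinite, so the space
is cut in a Borel way into finite cells. Circulations around triangles make the flow integral on all
edges between cells, and then each cell is rounded on its own.

The cells come from a toast (`exists_toast`): a Borel family of finite sets that cover the space,
such that no triangle of the graph crosses two of them. A triangle containing an edge that leaves a
member crosses that member, hence no other one, so corrections made for different members do not
disturb each other.

For one finite `S` in `ℤ^d`, two boundary edges are linked if triangles crossing `S` can carry flow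
from one to the other. The total flow through a linked class is an integer
(`sum_linked_mem_integers`): the indicator of the class is a finitely supported closed cochain, for
`2 ≤ d` it is the coboundary of a finitely supported integer function `g` (`exists_potential`), and
summation by parts turns the flow through the class into the sum of `g` times the divergence. So
gathering the flow of each class on one edge makes the whole boundary integral (`exists_filling`).

The coefficients of the triangles matter only modulo one, so they can be taken of absolute value at
most one. An edge then changes by at most `3 ^ d - 1` (`exists_integral_on_boundaries`), and
rounding inside the cells costs at most one more (`exists_integral_of_integral_between_cells`). -/

namespace BorelFlow

/-- The subgroup of integers in `ℝ`. -/
def integers : AddSubgroup ℝ := (Int.castAddHom ℝ).range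

theorem mem_integers {r : ℝ} : r ∈ integers ↔ ∃ n : ℤ, r = n := by
  unfold integers
  rw [AddMonoidHom.mem_range]
  simp [eq_comm]

theorem intCast_mem_integers (n : ℤ) : (n : ℝ) ∈ integers := mem_integers.2 ⟨n, rfl⟩

/-! ### Rounding flows on finite graphs. -/

section Rounding

variable {V : Type*} [Fintype V]

/-- The sum of an antisymmetric matrix over a square block vanishes. -/
theorem sum_sum_eq_zero_of_antisymm {ι : Type*} (s : Finset ι) (v : ι → ι → ℝ)
    (hv : ∀ i j, v i j = - v j i) : ∑ i ∈ s, ∑ j ∈ s, v i j = 0 := by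
  have h : ∑ i ∈ s, ∑ j ∈ s, v i j = - ∑ i ∈ s, ∑ j ∈ s, v i j := by
    conv_rhs => rw [Finset.sum_comm]
    simp only [← Finset.sum_neg_distrib]
    exact Finset.sum_congr rfl fun i _ => Finset.sum_congr rfl fun j _ => hv i j
  linarith

/-- If an antisymmetric matrix with integer row sums has a non-integer entry, then there is a
nonzero antisymmetric matrix with zero row sums supported on the non-integer entries. -/
theorem exists_circulation (φ : V → V → ℝ) (hφ : ∀ i j, φ i j = - φ j i)
    (hsum : ∀ i, ∑ j, φ i j ∈ integers) {x y : V} (hxy : φ x y ∉ integers) :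
    ∃ v : V → V → ℝ, (∀ i j, v i j = - v j i) ∧ (∀ i j, v i j ≠ 0 → φ i j ∉ integers) ∧
      (∀ i, ∑ j, v i j = 0) ∧ v x y ≠ 0 := by
  classical
  have hne : x ≠ y := by
    rintro rfl
    apply hxy
    have h0 : φ x x = 0 := by linarith [hφ x x]
    rw [h0]
    exact integers.zero_mem
  have hyx : φ y x ∉ integers := fun h => hxy (by rw [hφ x y]; exact integers.neg_mem h)
  -- The unit flow along the single edge from `a` to `b`.
  let e : V → V → V → V → ℝ := fun a b i j =>
    (if i = a ∧ j = b then 1 else 0) - (if i = b ∧ j = a then 1 else 0)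
  have he_anti : ∀ a b i j, e a b i j = - e a b j i := by
    intro a b i j
    have h1 : (j = a ∧ i = b) ↔ (i = b ∧ j = a) := and_comm
    have h2 : (j = b ∧ i = a) ↔ (i = a ∧ j = b) := and_comm
    simp only [e, h1, h2]
    ring
  have he_sum : ∀ a b i, ∑ j, e a b i j = (if i = a then 1 else 0) - (if i = b then 1 else 0) := by
    intro a b i
    simp only [e, Finset.sum_sub_distrib, ite_and]
    by_cases h1 : i = a <;> by_cases h2 : i = b <;> simp [h1, h2]
  -- Reachability: a unit of flow can be sent from `x` to `z` through non-integral edges without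
  -- using the edge between `x` and `y`.
  let P : V → Prop := fun z => ∃ v : V → V → ℝ, (∀ i j, v i j = - v j i) ∧
    (∀ i j, v i j ≠ 0 → φ i j ∉ integers) ∧ v x y = 0 ∧
      ∀ i, ∑ j, v i j = (if i = x then 1 else 0) - (if i = z then 1 else 0)
  have hPx : P x := ⟨fun _ _ => 0, by simp, by simp, rfl, by simp⟩
  have hPstep : ∀ z w, P z → φ z w ∉ integers → (z, w) ≠ (x, y) → (z, w) ≠ (y, x) → P w := by
    rintro z w ⟨v, h1, h2, h3, h4⟩ hzw hn1 hn2
    refine ⟨fun i j => v i j + e z w i j, ?_, ?_, ?_, ?_⟩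
    · intro i j
      beta_reduce
      rw [h1 i j, he_anti z w i j]; ring
    · intro i j hij
      beta_reduce at hij
      by_cases hv : v i j = 0
      · rw [hv, zero_add] at hij
        by_cases c1 : i = z ∧ j = w
        · rw [c1.1, c1.2]; exact hzw
        · by_cases c2 : i = w ∧ j = z
          · rw [c2.1, c2.2]
            intro h
            exact hzw (by rw [hφ z w]; exact integers.neg_mem h)
          · exact absurd (by simp [e, c1, c2]) hij
      · exact h2 i j hv
    · have c1 : ¬ (x = z ∧ y = w) := fun h => hn1 (by rw [h.1, h.2])
      have c2 : ¬ (x = w ∧ y = z) := fun h => hn2 (by rw [h.1, h.2])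
      simp [e, c1, c2, h3]
    · intro i
      rw [Finset.sum_add_distrib, h4, he_sum]; ring
  -- If `y` is reachable, the edge from `y` back to `x` closes the path to a circulation. Otherwise
  -- `(x, y)` is the only possibly non-integral edge out of the reachable set, and the net flow out
  -- of that set is an integer.
  by_cases hPy : P y
  · obtain ⟨v, h1, h2, h3, h4⟩ := hPy
    refine ⟨fun i j => v i j + e y x i j, ?_, ?_, ?_, ?_⟩
    · intro i j
      beta_reduce
      rw [h1 i j, he_anti y x i j]; ring
    · intro i j hij
      beta_reduce at hij
      by_cases hv : v i j = 0
      · rw [hv, zero_add] at hij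
        by_cases c1 : i = y ∧ j = x
        · rw [c1.1, c1.2]; exact hyx
        · by_cases c2 : i = x ∧ j = y
          · rw [c2.1, c2.2]; exact hxy
          · exact absurd (by simp [e, c1, c2]) hij
      · exact h2 i j hv
    · intro i
      rw [Finset.sum_add_distrib, h4, he_sum]; ring
    · have c1 : ¬ (x = y ∧ y = x) := fun h => hne h.1
      simp [e, c1, h3]
  · exfalso
    apply hxy
    let C : Finset V := Finset.univ.filter P
    have hC : ∀ i, i ∈ C ↔ P i := by simp [C]
    have h1 : ∑ i ∈ C, ∑ j, φ i j ∈ integers := integers.sum_mem fun i _ => hsum i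
    have h2 : ∑ i ∈ C, ∑ j, φ i j = ∑ i ∈ C, ∑ j ∈ Cᶜ, φ i j := by
      have h3 := sum_sum_eq_zero_of_antisymm C φ hφ
      have h4 : ∀ i, ∑ j, φ i j = ∑ j ∈ C, φ i j + ∑ j ∈ Cᶜ, φ i j := fun i =>
        (Finset.sum_add_sum_compl C _).symm
      simp only [h4, Finset.sum_add_distrib, h3, zero_add]
    rw [h2, ← Finset.sum_product', ← Finset.add_sum_erase _ _ (a := (x, y))
      (by simp [hC, hPx, hPy])] at h1
    have h3 : ∑ p ∈ (C ×ˢ Cᶜ).erase (x, y), φ p.1 p.2 ∈ integers := by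
      refine integers.sum_mem fun p hp => ?_
      obtain ⟨a, b⟩ := p
      simp only [Finset.mem_erase, Finset.mem_product, Finset.mem_compl, hC] at hp
      by_contra hab
      refine hp.2.2 (hPstep a b hp.2.1 hab hp.1 ?_)
      intro h
      apply hPy
      have : a = y := congrArg Prod.fst h
      rw [← this]
      exact hp.2.1
    have := integers.sub_mem h1 h3
    simpa using this

/-- An antisymmetric real matrix with integer row sums can be rounded to an antisymmetric integer
matrix with the same row sums. -/
theorem exists_rounding (φ : V → V → ℝ) (hφ : ∀ i j, φ i j = - φ j i)
    (hsum : ∀ i, ∑ j, φ i j ∈ integers) :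
    ∃ z : V → V → ℤ, (∀ i j, z i j = - z j i) ∧
      (∀ i j, ⌊φ i j⌋ ≤ z i j ∧ z i j ≤ ⌈φ i j⌉) ∧ ∀ i, ∑ j, (z i j : ℝ) = ∑ j, φ i j := by
  classical
  -- Induction on the number of non-integral entries: push along a circulation until the first entry
  -- becomes an integer.
  induction hk : (Finset.univ.filter fun p : V × V => φ p.1 p.2 ∉ integers).card
    using Nat.strong_induction_on generalizing φ with
  | _ k ih =>
    subst hk
    by_cases hall : ∀ i j, φ i j ∈ integers
    · choose z hz using fun i j => mem_integers.1 (hall i j)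
      refine ⟨z, ?_, ?_, ?_⟩
      · intro i j
        have := hφ i j
        rw [hz i j, hz j i] at this
        exact_mod_cast this
      · intro i j
        rw [hz i j]
        simp
      · intro i
        simp only [hz]
    · push Not at hall
      obtain ⟨x, y, hxy⟩ := hall
      obtain ⟨v, hv1, hv2, hv3, hv4⟩ := exists_circulation φ hφ hsum hxy
      let T : Finset (V × V) := Finset.univ.filter fun p => v p.1 p.2 ≠ 0
      -- The time at which the entry `p`, moving with velocity `v`, reaches its ceiling or floor;
      -- stopping at the minimum keeps every entry between its original floor and ceiling.
      let s : V × V → ℝ := fun p => if 0 < v p.1 p.2 then (⌈φ p.1 p.2⌉ - φ p.1 p.2) / v p.1 p.2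
        else (⌊φ p.1 p.2⌋ - φ p.1 p.2) / v p.1 p.2
      have hT : T.Nonempty := ⟨(x, y), by simp [T, hv4]⟩
      obtain ⟨p, hpT, hpmin⟩ := T.exists_min_image s hT
      have hs0 : ∀ q, v q.1 q.2 ≠ 0 → 0 ≤ s q := by
        intro q hq
        simp only [s]
        split_ifs with h
        · exact div_nonneg (sub_nonneg.2 (Int.le_ceil _)) h.le
        · exact div_nonneg_of_nonpos (sub_nonpos.2 (Int.floor_le _)) (not_lt.1 h)
      have hpv : v p.1 p.2 ≠ 0 := by simpa [T] using hpT
      have hsp := hs0 p hpv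
      let φ' : V → V → ℝ := fun i j => φ i j + s p * v i j
      have hbd : ∀ i j, (⌊φ i j⌋ : ℝ) ≤ φ' i j ∧ φ' i j ≤ ⌈φ i j⌉ := by
        intro i j
        by_cases h0 : v i j = 0
        · simp only [φ', h0, mul_zero, add_zero]
          exact ⟨Int.floor_le _, Int.le_ceil _⟩
        · have hm := hpmin (i, j) (by simp [T, h0])
          have hf := Int.floor_le (φ i j)
          have hc := Int.le_ceil (φ i j)
          rcases lt_or_gt_of_ne h0 with h | h
          · have he : s (i, j) = (⌊φ i j⌋ - φ i j) / v i j := by simp [s, not_lt.2 h.le]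
            rw [he, le_div_iff_of_neg h] at hm
            refine ⟨by simp only [φ']; linarith, ?_⟩
            have := mul_nonpos_of_nonneg_of_nonpos hsp h.le
            simp only [φ']; linarith
          · have he : s (i, j) = (⌈φ i j⌉ - φ i j) / v i j := by simp [s, h]
            rw [he, le_div_iff₀ h] at hm
            refine ⟨?_, by simp only [φ']; linarith⟩
            have := mul_nonneg hsp h.le
            simp only [φ']; linarith
      have hfix : ∀ i j, φ i j ∈ integers → φ' i j = φ i j := by
        intro i j hij
        have : v i j = 0 := by
          by_contra h
          exact hv2 i j h hij
        simp [φ', this]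
      have hpint : φ' p.1 p.2 ∈ integers := by
        simp only [φ', s]
        split_ifs with h
        · rw [div_mul_cancel₀ _ hpv, add_sub_cancel]
          exact intCast_mem_integers _
        · rw [div_mul_cancel₀ _ hpv, add_sub_cancel]
          exact intCast_mem_integers _
      have hsum' : ∀ i, ∑ j, φ' i j = ∑ j, φ i j := by
        intro i
        simp only [φ', Finset.sum_add_distrib, ← Finset.mul_sum, hv3, mul_zero, add_zero]
      have hφ' : ∀ i j, φ' i j = - φ' j i := by
        intro i j
        simp only [φ']
        rw [hφ i j, hv1 i j]; ring
      obtain ⟨z, hz1, hz2, hz3⟩ := ih _ (by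
        apply Finset.card_lt_card
        rw [Finset.ssubset_iff_of_subset]
        · refine ⟨p, ?_, ?_⟩
          · simpa using hv2 _ _ hpv
          · simpa using hpint
        · intro q
          simp only [Finset.mem_filter, Finset.mem_univ, true_and]
          intro h1 h2
          exact h1 (by rw [hfix _ _ h2]; exact h2)) φ' hφ'
        (fun i => by rw [hsum']; exact hsum i) rfl
      refine ⟨z, hz1, fun i j => ⟨?_, ?_⟩, fun i => by rw [hz3, hsum']⟩
      · exact (Int.le_floor.2 (hbd i j).1).trans (hz2 i j).1
      · exact (hz2 i j).2.trans (Int.ceil_le.2 (hbd i j).2)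

end Rounding


/-! ### Sup norm balls in `ℤ^d`. -/

section Box

/-- The ball of radius `R` around `0` in `ℤ^d` for the sup norm. -/
noncomputable def box (d : ℕ) (R : ℤ) : Finset (Fin d → ℤ) := Finset.Icc (fun _ => -R) (fun _ => R)

variable {d : ℕ}

theorem mem_box {R : ℤ} {γ : Fin d → ℤ} : γ ∈ box d R ↔ ∀ i, |γ i| ≤ R := by
  simp only [box, Finset.mem_Icc, Pi.le_def, abs_le]
  exact forall_and.symm

theorem zero_mem_box {R : ℤ} (hR : 0 ≤ R) : (0 : Fin d → ℤ) ∈ box d R :=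
  mem_box.2 fun i => by simpa using hR

theorem neg_mem_box {R : ℤ} {γ : Fin d → ℤ} (h : γ ∈ box d R) : -γ ∈ box d R :=
  mem_box.2 fun i => by simpa using mem_box.1 h i

theorem sub_mem_box_comm {R : ℤ} {α β : Fin d → ℤ} (h : α - β ∈ box d R) : β - α ∈ box d R := by
  rw [← neg_sub]
  exact neg_mem_box h

theorem add_mem_box {R R' : ℤ} {γ γ' : Fin d → ℤ} (h : γ ∈ box d R) (h' : γ' ∈ box d R') :
    γ + γ' ∈ box d (R + R') :=
  mem_box.2 fun i => (abs_add_le _ _).trans (add_le_add (mem_box.1 h i) (mem_box.1 h' i))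

theorem box_mono {R R' : ℤ} (h : R ≤ R') {γ : Fin d → ℤ} (hγ : γ ∈ box d R) : γ ∈ box d R' :=
  mem_box.2 fun i => (mem_box.1 hγ i).trans h

theorem card_box (R : ℤ) : (box d R).card = (2 * R + 1).toNat ^ d := by
  rw [box, Pi.card_Icc]
  simp only [Int.card_Icc, Finset.prod_const, Finset.card_univ, Fintype.card_fin]
  congr 2
  ring

theorem exists_mem_box (γ : Fin d → ℤ) : ∃ n : ℕ, γ ∈ box d n := by
  refine ⟨∑ i, (γ i).natAbs, mem_box.2 fun i => ?_⟩
  have := Finset.single_le_sum (f := fun i => (γ i).natAbs) (fun _ _ => Nat.zero_le _)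
    (Finset.mem_univ i)
  rw [Int.abs_eq_natAbs]
  exact_mod_cast this

theorem exists_subset_box (S : Finset (Fin d → ℤ)) : ∃ n : ℕ, ∀ γ ∈ S, γ ∈ box d n := by
  choose n hn using fun γ : Fin d → ℤ => exists_mem_box γ
  refine ⟨∑ γ ∈ S, n γ, fun γ hγ => box_mono ?_ (hn γ)⟩
  exact_mod_cast Finset.single_le_sum (f := n) (fun _ _ => Nat.zero_le _) hγ

theorem norm_eq_one_iff {γ : Fin d → ℤ} : ‖γ‖ = 1 ↔ γ ∈ box d 1 ∧ γ ≠ 0 := by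
  constructor
  · intro h
    refine ⟨mem_box.2 fun i => ?_, ?_⟩
    · have h1 : ‖γ i‖ ≤ 1 := (norm_le_pi_norm γ i).trans h.le
      rw [Int.norm_eq_abs] at h1
      exact_mod_cast h1
    · rintro rfl
      simp at h
  · rintro ⟨h, h0⟩
    apply le_antisymm
    · refine (pi_norm_le_iff_of_nonneg zero_le_one).2 fun i => ?_
      rw [Int.norm_eq_abs]
      exact_mod_cast mem_box.1 h i
    · obtain ⟨i, hi⟩ := Function.ne_iff.1 h0
      refine le_trans ?_ (norm_le_pi_norm γ i)
      rw [Int.norm_eq_abs]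
      exact_mod_cast Int.one_le_abs hi

end Box

/-! ### Vanishing of compactly supported first cohomology of `ℤ^d` for `2 ≤ d`. -/

section Potential

variable {d : ℕ}

/-- A finitely supported integer cochain on the edges of `ℤ^d`, `2 ≤ d`, that vanishes around
triangles is the coboundary of a finitely supported function. -/
theorem exists_potential (hd : 2 ≤ d) (c : (Fin d → ℤ) → (Fin d → ℤ) → ℤ)
    (hclosed : ∀ x y z, y - x ∈ box d 1 → z - y ∈ box d 1 → z - x ∈ box d 1 →
      c x y + c y z = c x z)
    (R : ℤ) (hsupp : ∀ x y, c x y ≠ 0 → x ∈ box d R) :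
    ∃ g : (Fin d → ℤ) → ℤ, (∀ x, g x ≠ 0 → x ∈ box d R) ∧
      ∀ x y, y - x ∈ box d 1 → c x y = g x - g y := by
  classical
  let i₀ : Fin d := ⟨0, by omega⟩
  let i₁ : Fin d := ⟨1, by omega⟩
  have hi : i₁ ≠ i₀ := by simp [i₀, i₁, Fin.ext_iff]
  let e : Fin d → ℤ := Pi.single i₀ 1
  have he₀ : e i₀ = 1 := by simp [e]
  have he : ∀ i, i ≠ i₀ → e i = 0 := fun i h => by simp [e, h]
  have hc0 : ∀ x y i, R < |x i| → c x y = 0 := fun x y i h => by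
    by_contra h'
    exact absurd (mem_box.1 (hsupp x y h') i) (not_le.2 h)
  have ha : ∀ x, ∀ k : ℕ, (x + k • e) i₀ = x i₀ + k := fun x k => by
    simp [he₀]
  have hae : ∀ x, ∀ k : ℕ, ∀ i, i ≠ i₀ → (x + k • e) i = x i := fun x k i h => by
    simp [he i h]
  -- The potential at `x` is the sum of `c` along the ray from `x` in direction `e`; the ray has
  -- left the support after `N x` steps.
  let G : ℕ → (Fin d → ℤ) → ℤ := fun N x =>
    ∑ k ∈ Finset.range N, c (x + k • e) (x + (k + 1) • e)
  let N : (Fin d → ℤ) → ℕ := fun x => (R + 1 - x i₀).toNat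
  have hG : ∀ x M, N x ≤ M → G M x = G (N x) x := by
    intro x M hM
    symm
    refine Finset.sum_subset (Finset.range_mono hM) fun k _ hk => ?_
    apply hc0 _ _ i₀
    rw [ha]
    simp only [N, Finset.mem_range, not_lt] at hk
    have : R < x i₀ + k := by omega
    exact this.trans_le (le_abs_self _)
  -- The parallelogram is split into two triangles along whichever diagonal is short; the sign of
  -- the `i₀`-coordinate of `y - x` decides which one.
  have hsq : ∀ x y, y - x ∈ box d 1 → c x (x + e) + c (x + e) (y + e) = c x y + c y (y + e) := by
    intro x y hxy
    have hxy' := mem_box.1 hxy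
    have hb : e ∈ box d 1 := mem_box.2 fun i => by
      by_cases h : i = i₀
      · rw [h, he₀]; simp
      · rw [he i h]; simp
    have h1 : x + e - x ∈ box d 1 := by simpa using hb
    have h2 : y + e - y ∈ box d 1 := by simpa using hb
    have h3 : y + e - (x + e) ∈ box d 1 := by simpa using hxy
    rcases le_or_gt (y i₀) (x i₀) with h | h
    · have hdiag : y + e - x ∈ box d 1 := mem_box.2 fun i => by
        have := hxy' i
        by_cases hi' : i = i₀
        · subst hi'
          simp only [Pi.sub_apply, Pi.add_apply, he₀, abs_le] at this ⊢
          omega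
        · simpa [he i hi'] using this
      rw [hclosed x (x + e) (y + e) h1 h3 hdiag, hclosed x y (y + e) hxy h2 hdiag]
    · have hdiag : x + e - y ∈ box d 1 := mem_box.2 fun i => by
        have := hxy' i
        by_cases hi' : i = i₀
        · subst hi'
          simp only [Pi.sub_apply, Pi.add_apply, he₀, abs_le] at this ⊢
          omega
        · simpa [he i hi', abs_sub_comm] using this
      have e1 := hclosed x y (x + e) hxy hdiag h1
      have e2 := hclosed y (x + e) (y + e) hdiag h3 h2
      omega
  have hGxy : ∀ M x y, y - x ∈ box d 1 →
      G M x - G M y = c x y - c (x + M • e) (y + M • e) := by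
    intro M x y hxy
    induction M with
    | zero => simp [G]
    | succ M ih =>
      simp only [G, Finset.sum_range_succ] at ih ⊢
      have := hsq (x + M • e) (y + M • e) (by simpa using hxy)
      rw [add_assoc x, add_assoc y, ← succ_nsmul] at this
      omega
  let g : (Fin d → ℤ) → ℤ := fun x => G (N x) x
  have hg : ∀ x y, y - x ∈ box d 1 → c x y = g x - g y := by
    intro x y hxy
    have h1 := hGxy (max (N x) (N y)) x y hxy
    rw [hG x _ (le_max_left _ _), hG y _ (le_max_right _ _)] at h1
    rw [h1, hc0 (x + _) _ i₀, sub_zero]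
    rw [ha]
    have : N x ≤ max (N x) (N y) := le_max_left _ _
    generalize max (N x) (N y) = m at this
    simp only [N] at this
    have h2 : R < x i₀ + m := by omega
    exact h2.trans_le (le_abs_self _)
  have hg1 : ∀ x i, i ≠ i₀ → R < |x i| → g x = 0 := by
    intro x i hi' h
    refine Finset.sum_eq_zero fun k _ => hc0 _ _ i ?_
    rw [hae x k i hi']
    exact h
  have hg2 : ∀ x, R < x i₀ → g x = 0 := by
    intro x h
    refine Finset.sum_eq_zero fun k _ => hc0 _ _ i₀ ?_
    rw [ha x k]
    have : R < x i₀ + k := by omega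
    exact this.trans_le (le_abs_self _)
  -- Here the ray may run through the support, and `2 ≤ d` is needed: `c` vanishes on this
  -- half-space, so `g` is constant there in direction `i₁`, and far out in that direction the ray
  -- misses the support.
  have hg3 : ∀ x, x i₀ < -R → g x = 0 := by
    intro x h
    let e' : Fin d → ℤ := Pi.single i₁ 1
    have he' : ∀ k : ℕ, (x + k • e') i₀ = x i₀ := fun k => by simp [e', hi.symm]
    have he1 : ∀ k : ℕ, (x + k • e') i₁ = x i₁ + k := fun k => by simp [e']
    have hk : ∀ k : ℕ, g (x + k • e') = g x := by
      intro k
      induction k with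
      | zero => simp
      | succ k ih =>
        rw [← ih]
        have hb : x + (k + 1) • e' - (x + k • e') ∈ box d 1 := by
          rw [succ_nsmul, ← add_assoc, add_sub_cancel_left]
          refine mem_box.2 fun i => ?_
          by_cases h : i = i₁
          · rw [h]; simp [e']
          · simp [e', h]
        have h1 := hg _ _ hb
        rw [hc0 _ _ i₀] at h1
        · omega
        · rw [he']
          have h2 : R < -x i₀ := by omega
          exact h2.trans_le (neg_le_abs _)
    rw [← hk (R + 1 - x i₁).toNat]
    apply hg1 _ i₁ hi
    rw [he1]
    have : R < x i₁ + ((R + 1 - x i₁).toNat : ℤ) := by omega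
    exact this.trans_le (le_abs_self _)
  refine ⟨g, fun x hx => mem_box.2 fun i => ?_, hg⟩
  by_contra h
  rw [not_le] at h
  apply hx
  by_cases hi' : i = i₀
  · subst hi'
    rcases lt_abs.1 h with h | h
    · exact hg2 x h
    · exact hg3 x (by omega)
  · exact hg1 x i hi' h

end Potential

/-! ### Making a flow integral on the boundary of one finite set. -/

section Filling

variable {d : ℕ}

/-- The edges from `S` to its complement. -/
noncomputable def bdry (S : Finset (Fin d → ℤ)) : Finset ((Fin d → ℤ) × (Fin d → ℤ)) := by
  classical
  exact ((S ×ˢ box d 1).image fun p => (p.1, p.2 + p.1)).filter fun p => p.2 ∉ S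

theorem mem_bdry {S : Finset (Fin d → ℤ)} {p : (Fin d → ℤ) × (Fin d → ℤ)} :
    p ∈ bdry S ↔ p.1 ∈ S ∧ p.2 ∉ S ∧ p.2 - p.1 ∈ box d 1 := by
  obtain ⟨a, b⟩ := p
  simp only [bdry, Finset.mem_filter, Finset.mem_image, Finset.mem_product, Prod.exists,
    Prod.mk.injEq]
  constructor
  · rintro ⟨⟨a, γ, ⟨ha, hγ⟩, rfl, rfl⟩, hb⟩
    exact ⟨ha, hb, by simpa using hγ⟩
  · rintro ⟨ha, hb, h⟩
    exact ⟨⟨a, b - a, ⟨ha, h⟩, rfl, by simp⟩, hb⟩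

/-- An alternating integer function on the triangles of `ℤ^d` that meet both `S` and its
complement. -/
structure IsBdryChain (S : Finset (Fin d → ℤ))
    (K : (Fin d → ℤ) → (Fin d → ℤ) → (Fin d → ℤ) → ℤ) : Prop where
  swap₁₂ : ∀ x y z, K x y z = - K y x z
  swap₂₃ : ∀ x y z, K x y z = - K x z y
  near₁₂ : ∀ x y z, K x y z ≠ 0 → y - x ∈ box d 1
  meets : ∀ x y z, K x y z ≠ 0 → x ∈ S ∨ y ∈ S ∨ z ∈ S
  meets_compl : ∀ x y z, K x y z ≠ 0 → ¬ (x ∈ S ∧ y ∈ S ∧ z ∈ S)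

namespace IsBdryChain

variable {S : Finset (Fin d → ℤ)} {K K' : (Fin d → ℤ) → (Fin d → ℤ) → (Fin d → ℤ) → ℤ}

theorem near₁₃ (h : IsBdryChain S K) (x y z) (hK : K x y z ≠ 0) : z - x ∈ box d 1 :=
  h.near₁₂ x z y fun h0 => hK (by rw [h.swap₂₃, h0, neg_zero])

theorem near₂₃ (h : IsBdryChain S K) (x y z) (hK : K x y z ≠ 0) : z - y ∈ box d 1 :=
  h.near₁₃ y x z fun h0 => hK (by rw [h.swap₁₂, h0, neg_zero])

theorem zero : IsBdryChain S fun _ _ _ => 0 := ⟨by simp, by simp, by simp, by simp, by simp⟩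

theorem neg (h : IsBdryChain S K) : IsBdryChain S fun x y z => - K x y z where
  swap₁₂ x y z := by rw [h.swap₁₂]
  swap₂₃ x y z := by rw [h.swap₂₃]
  near₁₂ x y z hK := h.near₁₂ x y z (neg_ne_zero.1 hK)
  meets x y z hK := h.meets x y z (neg_ne_zero.1 hK)
  meets_compl x y z hK := h.meets_compl x y z (neg_ne_zero.1 hK)

theorem add (h : IsBdryChain S K) (h' : IsBdryChain S K') :
    IsBdryChain S fun x y z => K x y z + K' x y z := by
  have key : ∀ x y z, K x y z + K' x y z ≠ 0 → K x y z ≠ 0 ∨ K' x y z ≠ 0 := by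
    intro x y z h
    by_contra! h'
    exact h (by rw [h'.1, h'.2, add_zero])
  refine ⟨?_, ?_, ?_, ?_, ?_⟩
  · intro x y z; rw [h.swap₁₂ x, h'.swap₁₂ x]; ring
  · intro x y z; rw [h.swap₂₃ x, h'.swap₂₃ x]; ring
  · exact fun x y z hK => (key x y z hK).elim (h.near₁₂ x y z) (h'.near₁₂ x y z)
  · exact fun x y z hK => (key x y z hK).elim (h.meets x y z) (h'.meets x y z)
  · exact fun x y z hK => (key x y z hK).elim (h.meets_compl x y z) (h'.meets_compl x y z)

end IsBdryChain

open Classical in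
/-- The indicator of an ordered triple. -/
noncomputable def tripleInd (p q r x y z : Fin d → ℤ) : ℤ := if x = p ∧ y = q ∧ z = r then 1 else 0

theorem tripleInd_swap₁₂ (p q r x y z : Fin d → ℤ) :
    tripleInd p q r y x z = tripleInd q p r x y z := by
  unfold tripleInd
  congr 1
  exact propext and_left_comm

theorem tripleInd_swap₂₃ (p q r x y z : Fin d → ℤ) :
    tripleInd p q r x z y = tripleInd p r q x y z := by
  unfold tripleInd
  congr 1
  exact propext (and_congr_right fun _ => and_comm)

theorem tripleInd_ne_zero {p q r x y z : Fin d → ℤ} (h : tripleInd p q r x y z ≠ 0) :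
    x = p ∧ y = q ∧ z = r := by
  unfold tripleInd at h
  by_contra h'
  exact h (if_neg h')

open Classical in
theorem sum_tripleInd (p q r x y : Fin d → ℤ) (h : r - p ∈ box d 1) :
    ∑ γ ∈ box d 1, tripleInd p q r x y (γ + x) = if x = p ∧ y = q then 1 else 0 := by
  unfold tripleInd
  by_cases h1 : x = p ∧ y = q
  · obtain ⟨rfl, rfl⟩ := h1
    rw [Finset.sum_eq_single (r - x)]
    · simp
    · intro γ _ hγ
      rw [if_neg]
      rintro ⟨-, -, rfl⟩
      simp at hγ
    · exact fun h' => absurd h h'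
  · rw [if_neg h1]
    refine Finset.sum_eq_zero fun γ _ => if_neg fun h' => h1 ⟨h'.1, h'.2.1⟩

/-- The alternating indicator of a triangle. -/
noncomputable def triangle (p q r x y z : Fin d → ℤ) : ℤ :=
  tripleInd p q r x y z + tripleInd q r p x y z + tripleInd r p q x y z
    - tripleInd q p r x y z - tripleInd r q p x y z - tripleInd p r q x y z

theorem triangle_isBdryChain {S : Finset (Fin d → ℤ)} {p q r : Fin d → ℤ}
    (hpq : q - p ∈ box d 1) (hqr : r - q ∈ box d 1) (hpr : r - p ∈ box d 1)
    (hS : p ∈ S ∨ q ∈ S ∨ r ∈ S) (hS' : ¬ (p ∈ S ∧ q ∈ S ∧ r ∈ S)) :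
    IsBdryChain S (triangle p q r) := by
  have hqp := sub_mem_box_comm hpq
  have hrq := sub_mem_box_comm hqr
  have hrp := sub_mem_box_comm hpr
  have key : ∀ P : (Fin d → ℤ) → (Fin d → ℤ) → (Fin d → ℤ) → Prop, P p q r → P q r p → P r p q →
      P q p r → P r q p → P p r q → ∀ x y z, triangle p q r x y z ≠ 0 → P x y z := by
    intro P h1 h2 h3 h4 h5 h6 x y z hK
    by_contra hP
    have h0 : ∀ p q r : Fin d → ℤ, P p q r → tripleInd p q r x y z = 0 := by
      intro p q r hp
      by_contra h
      obtain ⟨rfl, rfl, rfl⟩ := tripleInd_ne_zero h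
      exact hP hp
    apply hK
    rw [triangle, h0 _ _ _ h1, h0 _ _ _ h2, h0 _ _ _ h3, h0 _ _ _ h4, h0 _ _ _ h5, h0 _ _ _ h6]
    simp
  refine ⟨?_, ?_, ?_, ?_, ?_⟩
  · intro x y z
    simp only [triangle, tripleInd_swap₁₂ _ _ _ x y]
    ring
  · intro x y z
    simp only [triangle, tripleInd_swap₂₃ _ _ _ x y z]
    ring
  · exact key (fun x y _ => y - x ∈ box d 1) hpq hqr hrp hqp hrq hpr
  · refine key (fun x y z => x ∈ S ∨ y ∈ S ∨ z ∈ S) ?_ ?_ ?_ ?_ ?_ ?_ <;> tauto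
  · refine key (fun x y z => ¬ (x ∈ S ∧ y ∈ S ∧ z ∈ S)) ?_ ?_ ?_ ?_ ?_ ?_ <;> tauto

open Classical in
theorem sum_triangle {p q r : Fin d → ℤ}
    (hpq : q - p ∈ box d 1) (hqr : r - q ∈ box d 1) (hpr : r - p ∈ box d 1) (x y : Fin d → ℤ) :
    ∑ γ ∈ box d 1, triangle p q r x y (γ + x) =
      (if x = p ∧ y = q then 1 else 0) + (if x = q ∧ y = r then 1 else 0)
      + (if x = r ∧ y = p then 1 else 0) - (if x = q ∧ y = p then 1 else 0)
      - (if x = r ∧ y = q then 1 else 0) - (if x = p ∧ y = r then 1 else 0) := by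
  have hqp := sub_mem_box_comm hpq
  have hrq := sub_mem_box_comm hqr
  have hrp := sub_mem_box_comm hpr
  simp only [triangle, Finset.sum_sub_distrib, Finset.sum_add_distrib]
  rw [sum_tripleInd _ _ _ _ _ hpr, sum_tripleInd _ _ _ _ _ hqp, sum_tripleInd _ _ _ _ _ hrq,
    sum_tripleInd _ _ _ _ _ hqr, sum_tripleInd _ _ _ _ _ hrp, sum_tripleInd _ _ _ _ _ hpq]

open Classical in
/-- Two boundary edges of `S` are linked if some chain of triangles meeting `S` and its complement
has boundary `e' - e` when restricted to the boundary edges of `S`. -/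
def Linked (S : Finset (Fin d → ℤ)) (e e' : (Fin d → ℤ) × (Fin d → ℤ)) : Prop :=
  ∃ K, IsBdryChain S K ∧ ∀ p ∈ bdry S, ∑ γ ∈ box d 1, K p.1 p.2 (γ + p.1) =
    (if p = e' then 1 else 0) - (if p = e then 1 else 0)

theorem linked_equivalence (S : Finset (Fin d → ℤ)) : Equivalence (Linked S) where
  refl e := ⟨_, IsBdryChain.zero, by simp⟩
  symm := by
    rintro e e' ⟨K, hK, h⟩
    refine ⟨_, hK.neg, fun p hp => ?_⟩
    rw [Finset.sum_neg_distrib, h p hp]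
    ring
  trans := by
    rintro e e' e'' ⟨K, hK, h⟩ ⟨K', hK', h'⟩
    refine ⟨_, hK.add hK', fun p hp => ?_⟩
    rw [Finset.sum_add_distrib, h p hp, h' p hp]
    ring

/-- One triangle suffices: its third edge joins two points outside `S`, so it is not a boundary
edge. -/
theorem linked_of_common_fst {S : Finset (Fin d → ℤ)} {a b b' : Fin d → ℤ}
    (h : (a, b) ∈ bdry S) (h' : (a, b') ∈ bdry S) (hb : b' - b ∈ box d 1) :
    Linked S (a, b) (a, b') := by
  classical
  rw [mem_bdry] at h h'
  simp only at h h'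
  have hba := sub_mem_box_comm h.2.2
  refine ⟨triangle b a b', triangle_isBdryChain hba h'.2.2 hb (Or.inr (Or.inl h.1))
    fun h0 => h.2.1 h0.1, ?_⟩
  rintro ⟨x, y⟩ hp
  rw [mem_bdry] at hp
  have h1 : x ≠ b := fun h0 => h.2.1 (h0 ▸ hp.1)
  have h2 : x ≠ b' := fun h0 => h'.2.1 (h0 ▸ hp.1)
  rw [sum_triangle hba h'.2.2 hb]
  simp [h1, h2]

/-- The third edge of the triangle now lies inside `S`. -/
theorem linked_of_common_snd {S : Finset (Fin d → ℤ)} {a a' b : Fin d → ℤ}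
    (h : (a, b) ∈ bdry S) (h' : (a', b) ∈ bdry S) (ha : a' - a ∈ box d 1) :
    Linked S (a, b) (a', b) := by
  classical
  rw [mem_bdry] at h h'
  simp only at h h'
  have hba := sub_mem_box_comm h.2.2
  have ha' := sub_mem_box_comm ha
  refine ⟨triangle a' b a, triangle_isBdryChain h'.2.2 hba ha' (Or.inl h'.1)
    fun h0 => h.2.1 h0.2.1, ?_⟩
  rintro ⟨x, y⟩ hp
  rw [mem_bdry] at hp
  have h1 : x ≠ b := fun h0 => h.2.1 (h0 ▸ hp.1)
  have h2 : y ≠ a := fun h0 => hp.2.1 (h0 ▸ h.1)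
  have h3 : y ≠ a' := fun h0 => hp.2.1 (h0 ▸ h'.1)
  rw [sum_triangle h'.2.2 hba ha']
  simp [h1, h2, h3]

open Classical in
/-- The total flow through a class of linked boundary edges is an integer. -/
theorem sum_linked_mem_integers (hd : 2 ≤ d) (S : Finset (Fin d → ℤ))
    (Φ : (Fin d → ℤ) → (Fin d → ℤ) → ℝ) (hanti : ∀ x y, Φ x y = - Φ y x)
    (hsupp : ∀ x y, Φ x y ≠ 0 → y - x ∈ box d 1)
    (hsum : ∀ x, ∑ γ ∈ box d 1, Φ x (γ + x) ∈ integers) (e : (Fin d → ℤ) × (Fin d → ℤ)) :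
    ∑ p ∈ (bdry S).filter (fun p => Linked S e p), Φ p.1 p.2 ∈ integers := by
  obtain ⟨R, hR⟩ := exists_subset_box S
  let w : (Fin d → ℤ) → (Fin d → ℤ) → ℤ := fun x y =>
    if (x, y) ∈ bdry S ∧ Linked S e (x, y) then 1 else 0
  have hw0 : ∀ x y, ¬ (x ∈ S ∧ y ∉ S) → w x y = 0 := fun x y h =>
    if_neg fun h' => h ⟨(mem_bdry.1 h'.1).1, (mem_bdry.1 h'.1).2.1⟩
  have hwl : ∀ x y z, x ∈ S → y ∉ S → z ∉ S → y - x ∈ box d 1 → z - x ∈ box d 1 →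
      z - y ∈ box d 1 → w x y = w x z := by
    intro x y z hx hy hz hxy hxz hyz
    have h1 : (x, y) ∈ bdry S := mem_bdry.2 ⟨hx, hy, hxy⟩
    have h2 : (x, z) ∈ bdry S := mem_bdry.2 ⟨hx, hz, hxz⟩
    have h3 := linked_of_common_fst h1 h2 hyz
    have : Linked S e (x, y) ↔ Linked S e (x, z) :=
      ⟨fun h => (linked_equivalence S).trans h h3,
        fun h => (linked_equivalence S).trans h ((linked_equivalence S).symm h3)⟩
    simp only [w, h1, h2, this]
  have hwr : ∀ x y z, x ∈ S → y ∈ S → z ∉ S → z - x ∈ box d 1 → z - y ∈ box d 1 →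
      y - x ∈ box d 1 → w x z = w y z := by
    intro x y z hx hy hz hxz hyz hxy
    have h1 : (x, z) ∈ bdry S := mem_bdry.2 ⟨hx, hz, hxz⟩
    have h2 : (y, z) ∈ bdry S := mem_bdry.2 ⟨hy, hz, hyz⟩
    have h3 := linked_of_common_snd h1 h2 hxy
    have : Linked S e (x, z) ↔ Linked S e (y, z) :=
      ⟨fun h => (linked_equivalence S).trans h h3,
        fun h => (linked_equivalence S).trans h ((linked_equivalence S).symm h3)⟩
    simp only [w, h1, h2, this]
  -- The antisymmetrized indicator of the class is closed: a triangle crossing `S` has exactly two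
  -- boundary edges, they share an endpoint, hence are linked, and `w` agrees on them.
  obtain ⟨g, hgR, hg⟩ := exists_potential hd (fun x y => w x y - w y x) (by
    intro x y z hxy hyz hxz
    have hyx := sub_mem_box_comm hxy
    have hzy := sub_mem_box_comm hyz
    have hzx := sub_mem_box_comm hxz
    by_cases hx : x ∈ S <;> by_cases hy : y ∈ S <;> by_cases hz : z ∈ S
    · simp [hw0, hx, hy, hz]
    · have := hwr x y z hx hy hz hxz hyz hxy
      simp only [hw0 z y (by simp [hz]), hw0 z x (by simp [hz]), hw0 x y (by simp [hy]),
        hw0 y x (by simp [hx]), this]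
      ring
    · have := hwl y x z
      have := hwr x z y hx hz hy hxy hzy hxz
      simp only [hw0 y x (by simp [hy]), hw0 y z (by simp [hy]), hw0 x z (by simp [hz]),
        hw0 z x (by simp [hx]), this]
      ring
    · have := hwl x y z hx hy hz hxy hxz hyz
      simp only [hw0 y x (by simp [hy]), hw0 z x (by simp [hz]), hw0 y z (by simp [hy]),
        hw0 z y (by simp [hz]), this]
      ring
    · have := hwr y z x hy hz hx hyx hzx hyz
      simp only [hw0 x y (by simp [hx]), hw0 x z (by simp [hx]), hw0 y z (by simp [hz]),
        hw0 z y (by simp [hy]), this]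
      ring
    · have := hwl y x z hy hx hz hyx hyz hxz
      simp only [hw0 x y (by simp [hx]), hw0 x z (by simp [hx]), hw0 z y (by simp [hz]),
        hw0 z x (by simp [hz]), this]
      ring
    · have := hwl z x y hz hx hy hzx hzy hxy
      simp only [hw0 x y (by simp [hx]), hw0 x z (by simp [hx]), hw0 y x (by simp [hy]),
        hw0 y z (by simp [hy]), this]
      ring
    · simp [hw0, hx, hy, hz]) (R + 1) (by
    intro x y hxy
    by_cases h1 : (x, y) ∈ bdry S
    · exact box_mono (by omega) (hR x (mem_bdry.1 h1).1)
    · by_cases h2 : (y, x) ∈ bdry S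
      · have := mem_bdry.1 h2
        simpa using add_mem_box (hR y this.1) this.2.2
      · exact absurd (by simp [w, h1, h2]) hxy)
  -- Large enough to contain all neighbours of the support of `g`, so that summing over `U` gives
  -- the full divergence there.
  let U := box d (R + 2)
  have hΦsum : ∀ x ∈ box d (R + 1), ∑ y ∈ U, Φ x y ∈ integers := by
    intro x hx
    have h1 : ∑ γ ∈ box d 1, Φ x (γ + x) = ∑ y ∈ U, Φ x y := by
      refine Finset.sum_bij_ne_zero (fun γ _ _ => γ + x) ?_ ?_ ?_ ?_
      · intro γ hγ _
        have := add_mem_box hγ hx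
        exact box_mono (by omega) this
      · intro γ _ _ γ' _ _ h
        exact add_right_cancel h
      · intro y _ hy
        exact ⟨y - x, hsupp x y hy, by simpa using hy, by simp⟩
      · intros; rfl
    rw [← h1]
    exact hsum x
  have hcw : ∀ x y, ((w x y : ℝ) - w y x) * Φ x y = (g x - g y) * Φ x y := by
    intro x y
    by_cases h : Φ x y = 0
    · simp [h]
    · have := hg x y (hsupp x y h)
      congr 1
      exact_mod_cast this
  have hswap : ∀ h : (Fin d → ℤ) → (Fin d → ℤ) → ℝ, ∑ x ∈ U, ∑ y ∈ U, h y x * Φ x y =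
      - ∑ x ∈ U, ∑ y ∈ U, h x y * Φ x y := by
    intro h
    rw [Finset.sum_comm]
    simp only [← Finset.sum_neg_distrib]
    refine Finset.sum_congr rfl fun x _ => Finset.sum_congr rfl fun y _ => ?_
    rw [hanti y x]; ring
  -- Summation by parts: antisymmetry of `Φ` doubles both sums, which identifies the flow through
  -- the class with `g` paired with the divergence.
  have e1 : ∑ x ∈ U, ∑ y ∈ U, ((w x y : ℝ) - w y x) * Φ x y =
      2 * ∑ x ∈ U, ∑ y ∈ U, (w x y : ℝ) * Φ x y := by
    have := hswap fun x y => (w x y : ℝ)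
    simp only [sub_mul, Finset.sum_sub_distrib]
    linarith
  have e2 : ∑ x ∈ U, ∑ y ∈ U, ((g x : ℝ) - g y) * Φ x y =
      2 * ∑ x ∈ U, ∑ y ∈ U, (g x : ℝ) * Φ x y := by
    have := hswap fun x _ => (g x : ℝ)
    simp only [sub_mul, Finset.sum_sub_distrib]
    linarith
  simp only [hcw] at e1
  have e3 : ∑ x ∈ U, ∑ y ∈ U, (w x y : ℝ) * Φ x y = ∑ x ∈ U, ∑ y ∈ U, (g x : ℝ) * Φ x y := by
    linarith
  have e4 : ∑ x ∈ U, ∑ y ∈ U, (g x : ℝ) * Φ x y ∈ integers := by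
    refine integers.sum_mem fun x _ => ?_
    rw [← Finset.mul_sum]
    by_cases hx : g x = 0
    · simp only [hx, Int.cast_zero, zero_mul]
      exact integers.zero_mem
    · obtain ⟨n, hn⟩ := mem_integers.1 (hΦsum x (hgR x hx))
      rw [hn]
      exact mem_integers.2 ⟨g x * n, by push_cast; ring⟩
  rw [← e3] at e4
  convert e4 using 1
  rw [← Finset.sum_product']
  symm
  rw [← Finset.sum_filter_of_ne (p := fun p => p ∈ bdry S ∧ Linked S e p)]
  · refine Finset.sum_congr ?_ fun p hp => ?_
    · ext p
      simp only [Finset.mem_filter, Finset.mem_product, and_iff_right_iff_imp, and_imp]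
      intro hp _
      have h := mem_bdry.1 hp
      have h1 := hR _ h.1
      have h2 := add_mem_box h1 h.2.2
      rw [add_sub_cancel] at h2
      exact ⟨box_mono (by omega) h1, box_mono (by omega) h2⟩
    · simp only [Finset.mem_filter] at hp
      simp [w, hp.1, hp.2]
  · intro p _ hp
    by_contra h
    exact hp (by simp [w, h])

/-- For every finite set `S` there is a linear recipe that makes any flow with integer divergence
integral on the boundary edges of `S` by adding a chain of triangles that meet `S` and its
complement. -/
theorem exists_filling (hd : 2 ≤ d) (S : Finset (Fin d → ℤ)) :
    ∃ K : (Fin d → ℤ) × (Fin d → ℤ) → (Fin d → ℤ) → (Fin d → ℤ) → (Fin d → ℤ) → ℤ,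
      (∀ e, IsBdryChain S (K e)) ∧
      ∀ Φ : (Fin d → ℤ) → (Fin d → ℤ) → ℝ, (∀ x y, Φ x y = - Φ y x) →
        (∀ x y, Φ x y ≠ 0 → y - x ∈ box d 1) →
        (∀ x, ∑ γ ∈ box d 1, Φ x (γ + x) ∈ integers) →
        ∀ p ∈ bdry S, Φ p.1 p.2 +
          ∑ γ ∈ box d 1, ∑ e ∈ bdry S, Φ e.1 e.2 * K e p.1 p.2 (γ + p.1) ∈ integers := by
  classical
  let s : Setoid ((Fin d → ℤ) × (Fin d → ℤ)) := ⟨Linked S, linked_equivalence S⟩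
  -- `K e` moves flow from `e` to the representative of its class. Weighted by `Φ`, this leaves zero
  -- on every other edge and the integral total of the class on the representative.
  have hrep : ∀ e, Linked S e (Quotient.mk s e).out := fun e =>
    (linked_equivalence S).symm (Quotient.mk_out (s := s) e)
  choose K hK hKsum using hrep
  refine ⟨K, hK, fun Φ h1 h2 h3 p hp => ?_⟩
  have e1 : ∑ γ ∈ box d 1, ∑ e ∈ bdry S, Φ e.1 e.2 * (K e p.1 p.2 (γ + p.1) : ℝ) =
      ∑ e ∈ bdry S, (Φ e.1 e.2 * (if p = (Quotient.mk s e).out then 1 else 0)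
        - Φ e.1 e.2 * (if p = e then 1 else 0)) := by
    rw [Finset.sum_comm]
    refine Finset.sum_congr rfl fun e _ => ?_
    rw [← Finset.mul_sum, ← mul_sub]
    congr 1
    have := hKsum e p hp
    have h4 := congrArg (fun n : ℤ => (n : ℝ)) this
    simpa using h4
  rw [e1, Finset.sum_sub_distrib]
  have e2 : ∑ e ∈ bdry S, Φ e.1 e.2 * (if p = e then (1 : ℝ) else 0) = Φ p.1 p.2 := by
    rw [Finset.sum_eq_single p]
    · simp
    · intro e _ he
      simp [he.symm]
    · exact fun h => absurd hp h
  rw [e2, add_sub_cancel]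
  by_cases hpr : p = (Quotient.mk s p).out
  · have := sum_linked_mem_integers hd S Φ h1 h2 h3 p
    rw [Finset.sum_filter] at this
    convert this using 2 with e
    have : p = (Quotient.mk s e).out ↔ Linked S p e := by
      constructor
      · intro h
        rw [h]
        exact Quotient.mk_out (s := s) e
      · intro h
        rw [← Quotient.sound (s := s) h]
        exact hpr
    simp [this]
  · rw [Finset.sum_eq_zero]
    · exact integers.zero_mem
    · intro e _
      rw [if_neg, mul_zero]
      intro h
      apply hpr
      nth_rw 2 [h]
      rw [Quotient.out_eq]
      exact h

end Filling

/-! ### Distances within orbits. -/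

section Orbit

variable {d : ℕ} {X : Type*} [AddAction (Fin d → ℤ) X]

variable (d) in
/-- `y` is obtained from `x` by an element of `ℤ^d` of sup norm at most `R`. -/
def Near (R : ℤ) (x y : X) : Prop := ∃ γ ∈ box d R, γ +ᵥ x = y

theorem Near.refl {R : ℤ} (hR : 0 ≤ R) (x : X) : Near d R x x := ⟨0, zero_mem_box hR, zero_vadd _ _⟩

theorem Near.symm {R : ℤ} {x y : X} (h : Near d R x y) : Near d R y x := by
  obtain ⟨γ, hγ, rfl⟩ := h
  exact ⟨-γ, neg_mem_box hγ, neg_vadd_vadd γ x⟩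

theorem Near.trans {R R' : ℤ} {x y z : X} (h : Near d R x y) (h' : Near d R' y z) :
    Near d (R + R') x z := by
  obtain ⟨γ, hγ, rfl⟩ := h
  obtain ⟨γ', hγ', rfl⟩ := h'
  exact ⟨γ + γ', add_mem_box hγ hγ', by rw [add_comm, add_vadd]⟩

theorem Near.mono {R R' : ℤ} (hR : R ≤ R') {x y : X} (h : Near d R x y) : Near d R' x y := by
  obtain ⟨γ, hγ, rfl⟩ := h
  exact ⟨γ, box_mono hR hγ, rfl⟩

theorem IsFreeAction.vadd_injective (hfree : IsFreeAction d X) (x : X) :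
    Function.Injective fun γ : Fin d → ℤ => γ +ᵥ x := by
  intro γ γ' h
  have h1 : (-γ' + γ) +ᵥ x = x := by
    rw [add_vadd]
    simp only at h
    rw [h, neg_vadd_vadd]
  have := hfree _ _ h1
  rwa [neg_add_eq_zero, eq_comm] at this

theorem IsFreeAction.near_vadd_iff (hfree : IsFreeAction d X) {R : ℤ} {x : X}
    {α β : Fin d → ℤ} : Near d R (α +ᵥ x) (β +ᵥ x) ↔ β - α ∈ box d R := by
  constructor
  · rintro ⟨γ, hγ, h⟩
    rw [← add_vadd] at h
    rw [← hfree.vadd_injective x h]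
    simpa using hγ
  · intro h
    exact ⟨_, h, by rw [← add_vadd, sub_add_cancel]⟩

end Orbit

/-! ### Borel marker sets. -/

section Markers

open MeasureTheory

variable {d : ℕ} {X : Type*} [MeasurableSpace X]
  [AddAction (Fin d → ℤ) X] [MeasurableConstVAdd (Fin d → ℤ) X]

theorem measurableSet_vadd {s : Set X} (hs : MeasurableSet s) (γ : Fin d → ℤ) :
    MeasurableSet {x | γ +ᵥ x ∈ s} := measurable_const_vadd γ hs

variable [StandardBorelSpace X]

/-- A free Borel action has a countable cover by Borel sets that are separated at a given scale. -/
theorem exists_separated_cover (hfree : IsFreeAction d X) (s : ℤ) :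
    ∃ W : ℕ → Set X, (∀ n, MeasurableSet (W n)) ∧ (⋃ n, W n = Set.univ) ∧
      ∀ n, ∀ x ∈ W n, ∀ y ∈ W n, Near d s x y → x = y := by
  obtain ⟨q, hq⟩ := exists_surjective_nat (ℚ × ℚ)
  have hu := measurableEmbedding_embeddingReal X
  set u := embeddingReal X
  -- By freeness and injectivity of `u`, some rational interval around `u x` avoids the values of
  -- `u` at the finitely many other points near `x`.
  let I : ℕ → Set ℝ := fun n => Set.Ioo ((q n).1 : ℝ) ((q n).2 : ℝ)
  refine ⟨fun n => {x | u x ∈ I n ∧ ∀ γ ∈ box d s, γ ≠ 0 → u (γ +ᵥ x) ∉ I n}, ?_, ?_, ?_⟩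
  · intro n
    have hI : MeasurableSet {x | u x ∈ I n} := hu.measurable measurableSet_Ioo
    simp only [Set.ofPred_and, Set.ofPred_forall]
    exact hI.inter (MeasurableSet.iInter fun γ => MeasurableSet.iInter fun _ =>
      MeasurableSet.iInter fun _ => (measurableSet_vadd hI γ).compl)
  · refine Set.eq_univ_of_forall fun x => ?_
    let F : Set ℝ := (fun γ : Fin d → ℤ => u (γ +ᵥ x)) '' {γ | γ ∈ box d s ∧ γ ≠ 0}
    have hF : F.Finite := by
      refine Set.Finite.image _ (Set.Finite.subset (box d s).finite_toSet fun γ h => h.1)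
    have hxF : Fᶜ ∈ nhds (u x) := by
      refine hF.isClosed.isOpen_compl.mem_nhds ?_
      rintro ⟨γ, ⟨-, h0⟩, h⟩
      exact h0 (hfree γ x (hu.injective h))
    obtain ⟨l, r, ⟨hl, hr⟩, hlr⟩ := mem_nhds_iff_exists_Ioo_subset.1 hxF
    obtain ⟨a, ha1, ha2⟩ := exists_rat_btwn hl
    obtain ⟨b, hb1, hb2⟩ := exists_rat_btwn hr
    obtain ⟨n, hn⟩ := hq (a, b)
    refine Set.mem_iUnion.2 ⟨n, ?_, fun γ hγ h0 h => ?_⟩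
    · simp only [I, hn]
      exact ⟨ha2, hb1⟩
    · simp only [I, hn] at h
      exact hlr ⟨ha1.trans h.1, h.2.trans hb2⟩ ⟨γ, ⟨hγ, h0⟩, rfl⟩
  · rintro n x hx y hy ⟨γ, hγ, rfl⟩
    by_cases h0 : γ = 0
    · rw [h0, zero_vadd]
    · exact absurd hy.1 (hx.2 γ hγ h0)

/-- Every Borel set contains a Borel subset that is maximal among the subsets separated at a given
scale. -/
theorem exists_maximal_separated (hfree : IsFreeAction d X) {s : ℤ} (hs : 0 ≤ s) {Y : Set X}
    (hY : MeasurableSet Y) : ∃ M : Set X, MeasurableSet M ∧ M ⊆ Y ∧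
      (∀ x ∈ M, ∀ y ∈ M, Near d s x y → x = y) ∧ ∀ y ∈ Y, ∃ m ∈ M, Near d s y m := by
  obtain ⟨W, hW, hcov, hsep⟩ := exists_separated_cover hfree s
  -- Greedy construction: stage `n` adds all points of `Y ∩ W n` not close to points already chosen;
  -- `W n` is itself separated, so these additions do not conflict.
  let C : ℕ → Set X := fun n => Nat.rec ∅
    (fun n C => C ∪ {x | x ∈ Y ∧ x ∈ W n ∧ ∀ γ ∈ box d s, γ +ᵥ x ∉ C}) n
  have hC : ∀ n, C (n + 1) = C n ∪ {x | x ∈ Y ∧ x ∈ W n ∧ ∀ γ ∈ box d s, γ +ᵥ x ∉ C n} :=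
    fun _ => rfl
  have hmono : Monotone C := monotone_nat_of_le_succ fun n => by
    rw [hC]; exact Set.subset_union_left
  refine ⟨⋃ n, C n, MeasurableSet.iUnion fun n => ?_, Set.iUnion_subset fun n => ?_, ?_, ?_⟩
  · induction n with
    | zero => exact MeasurableSet.empty
    | succ n ih =>
      rw [hC]
      refine ih.union ?_
      simp only [Set.ofPred_and, Set.ofPred_forall]
      exact hY.inter ((hW n).inter (MeasurableSet.iInter fun γ => MeasurableSet.iInter fun _ =>
        (measurableSet_vadd ih γ).compl))
  · induction n with
    | zero => exact Set.empty_subset _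
    | succ n ih =>
      rw [hC]
      exact Set.union_subset ih fun x hx => hx.1
  · have key : ∀ n, ∀ x ∈ C n, ∀ y ∈ C n, Near d s x y → x = y := by
      intro n
      induction n with
      | zero => exact fun x hx => hx.elim
      | succ n ih =>
        rw [hC]
        rintro x (hx | ⟨-, hxW, hx⟩) y (hy | ⟨-, hyW, hy⟩) hxy
        · exact ih x hx y hy hxy
        · obtain ⟨γ, hγ, rfl⟩ := hxy.symm
          exact absurd hx (hy γ hγ)
        · obtain ⟨γ, hγ, rfl⟩ := hxy
          exact absurd hy (hx γ hγ)
        · exact hsep n x hxW y hyW hxy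
    intro x hx y hy hxy
    obtain ⟨i, hi⟩ := Set.mem_iUnion.1 hx
    obtain ⟨j, hj⟩ := Set.mem_iUnion.1 hy
    exact key (max i j) x (hmono (le_max_left _ _) hi) y (hmono (le_max_right _ _) hj) hxy
  · intro y hy
    obtain ⟨n, hn⟩ := Set.mem_iUnion.1 (hcov ▸ Set.mem_univ y : y ∈ ⋃ n, W n)
    rcases Classical.em (∃ γ ∈ box d s, γ +ᵥ y ∈ C n) with h | h
    · obtain ⟨γ, hγ, h⟩ := h
      exact ⟨γ +ᵥ y, Set.mem_iUnion.2 ⟨n, h⟩, γ, hγ, rfl⟩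
    · push Not at h
      refine ⟨y, Set.mem_iUnion.2 ⟨n + 1, ?_⟩, Near.refl hs y⟩
      rw [hC]
      exact Or.inr ⟨hy, hn, h⟩

/-- Among sufficiently many points of a ball of radius `6 r`, two are at distance at most `r`. -/
theorem exists_sub_mem_box {r : ℤ} (hr : 1 ≤ r) (γ : Fin ((box d 6).card + 1) → Fin d → ℤ)
    (hγ : ∀ k, γ k ∈ box d (6 * r)) : ∃ j k, j < k ∧ γ j - γ k ∈ box d r := by
  -- Pigeonhole on cubes with `r + 1` points per side: coordinates in `[-6r, 6r]` have quotients in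
  -- `[-6, 6]`.
  let cell : (Fin d → ℤ) → Fin d → ℤ := fun γ i => γ i / (r + 1)
  have hmaps : ∀ k ∈ (Finset.univ : Finset (Fin ((box d 6).card + 1))),
      cell (γ k) ∈ box d 6 := by
    intro k _
    refine mem_box.2 fun i => ?_
    have := abs_le.1 (mem_box.1 (hγ k) i)
    rw [abs_le]
    simp only [cell]
    constructor
    · rw [Int.le_ediv_iff_mul_le (by omega)]; linarith [this.1]
    · rw [← Int.lt_add_one_iff, Int.ediv_lt_iff_lt_mul (by omega)]; linarith [this.2]
  obtain ⟨j, -, k, -, hjk, h⟩ := Finset.exists_ne_map_eq_of_card_lt_of_maps_to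
    (by simp) hmaps
  have hbox : γ j - γ k ∈ box d r := by
    refine mem_box.2 fun i => ?_
    have h1 : γ j i / (r + 1) = γ k i / (r + 1) := congrFun h i
    have h2 := Int.mul_ediv_add_emod (γ j i) (r + 1)
    have h3 := Int.mul_ediv_add_emod (γ k i) (r + 1)
    have h4 := Int.emod_nonneg (γ j i) (b := r + 1) (by omega)
    have h5 := Int.emod_nonneg (γ k i) (b := r + 1) (by omega)
    have h6 := Int.emod_lt_of_pos (γ j i) (b := r + 1) (by omega)
    have h7 := Int.emod_lt_of_pos (γ k i) (b := r + 1) (by omega)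
    rw [h1] at h2
    rw [Pi.sub_apply, abs_le]
    constructor <;> linarith
  rcases lt_or_gt_of_ne hjk with h' | h'
  · exact ⟨j, k, h', hbox⟩
  · exact ⟨k, j, h', sub_mem_box_comm hbox⟩

/-- The balls of radius `r` around finitely many `6 r`-separated Borel sets cover `X`, where the
number of sets does not depend on `r`. -/
theorem exists_coloured_markers (hfree : IsFreeAction d X) {r : ℤ} (hr : 1 ≤ r) :
    ∃ M : Fin ((box d 6).card + 1) → Set X, (∀ k, MeasurableSet (M k)) ∧
      (∀ k, ∀ x ∈ M k, ∀ y ∈ M k, Near d (6 * r) x y → x = y) ∧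
      ∀ x, ∃ k, ∃ m ∈ M k, Near d r x m := by
  choose! M hM hMY hsep hmax using fun (Y : Set X) (hY : MeasurableSet Y) =>
    exists_maximal_separated hfree (s := 6 * r) (by omega) hY
  -- `Y n` consists of the points not within `r` of the first `n` marker sets. A point left
  -- uncovered by all sets would have a marker of every colour within `6 * r`; two of these would be
  -- within `r` of each other, although the later one was chosen away from the earlier.
  let Y : ℕ → Set X := fun n => Nat.rec Set.univ
    (fun _ Y => {x | x ∈ Y ∧ ∀ γ ∈ box d r, γ +ᵥ x ∉ M Y}) n
  have hYs : ∀ n, Y (n + 1) = {x | x ∈ Y n ∧ ∀ γ ∈ box d r, γ +ᵥ x ∉ M (Y n)} := fun _ => rfl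
  have hY : ∀ n, MeasurableSet (Y n) := by
    intro n
    induction n with
    | zero => exact MeasurableSet.univ
    | succ n ih =>
      rw [hYs]
      simp only [Set.ofPred_and, Set.ofPred_forall]
      exact ih.inter (MeasurableSet.iInter fun γ => MeasurableSet.iInter fun _ =>
        (measurableSet_vadd (hM _ ih) γ).compl)
  have hanti : Antitone Y := antitone_nat_of_succ_le fun n x hx => by
    rw [hYs] at hx
    exact hx.1
  refine ⟨fun k => M (Y k), fun k => hM _ (hY k), fun k => hsep _ (hY k), fun x => ?_⟩
  by_contra! hx
  have hxY : ∀ n, n ≤ (box d 6).card + 1 → x ∈ Y n := by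
    intro n
    induction n with
    | zero => exact fun _ => Set.mem_univ x
    | succ n ih =>
      intro hn
      rw [hYs]
      refine ⟨ih (by omega), fun γ hγ h => ?_⟩
      exact hx ⟨n, by omega⟩ _ h ⟨γ, hγ, rfl⟩
  have h1 : ∀ k : Fin ((box d 6).card + 1), ∃ γ ∈ box d (6 * r), γ +ᵥ x ∈ M (Y k) := by
    intro k
    obtain ⟨m, hm, γ, hγ, rfl⟩ := hmax _ (hY k) x (hxY k (by omega))
    exact ⟨γ, hγ, hm⟩
  choose γ hγ hγM using h1
  obtain ⟨j, k, hjk, h⟩ := exists_sub_mem_box hr γ hγ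
  have h2 : γ k +ᵥ x ∈ Y (j + 1) := hanti (by exact_mod_cast hjk) (hMY _ (hY k) (hγM k))
  rw [hYs] at h2
  apply h2.2 _ h
  rw [← add_vadd, sub_add_cancel]
  exact hγM j

/-- For a sequence of scales `r n ≥ n`, there are Borel `6 r n`-separated sets `M n` such that the
balls of radius `2 r n` around the points of `M n` together cover `X`. -/
theorem exists_markers (hfree : IsFreeAction d X) (r : ℕ → ℤ) (hr : ∀ n, 1 ≤ r n)
    (hrn : ∀ n : ℕ, (n : ℤ) ≤ r n) :
    ∃ M : ℕ → Set X, (∀ n, MeasurableSet (M n)) ∧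
      (∀ n, ∀ x ∈ M n, ∀ y ∈ M n, Near d (6 * r n) x y → x = y) ∧
      ∀ x, ∃ n, ∃ m ∈ M n, Near d (2 * r n) m x := by
  choose M hM hsep hcov using fun n => exists_coloured_markers hfree (hr n)
  -- `Z k` is an invariant set: the orbits with a point that is covered by colour `k` at infinitely
  -- many scales. Each orbit uses only its least such colour, which keeps the chosen markers
  -- separated.
  let Z : Fin ((box d 6).card + 1) → Set X := fun k =>
    {x | ∃ γ : Fin d → ℤ, ∀ N : ℕ, ∃ n : ℕ, N ≤ n ∧ ∃ δ ∈ box d (r n), δ +ᵥ γ +ᵥ x ∈ M n k}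
  have hZ : ∀ k, MeasurableSet (Z k) := by
    intro k
    simp only [Z, Set.ofPred_exists, Set.ofPred_forall, Set.ofPred_and]
    refine MeasurableSet.iUnion fun γ => MeasurableSet.iInter fun N => MeasurableSet.iUnion fun n =>
      (MeasurableSet.const _).inter (MeasurableSet.iUnion fun δ => (MeasurableSet.const _).inter ?_)
    exact measurableSet_vadd (measurableSet_vadd (hM n k) δ) γ
  have hZinv : ∀ k x (α : Fin d → ℤ), x ∈ Z k → α +ᵥ x ∈ Z k := by
    rintro k x α ⟨γ, h⟩
    refine ⟨γ - α, fun N => ?_⟩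
    obtain ⟨n, hn, δ, hδ, h⟩ := h N
    exact ⟨n, hn, δ, hδ, by rwa [← add_vadd (γ - α), sub_add_cancel]⟩
  have hZinv' : ∀ k x (α : Fin d → ℤ), α +ᵥ x ∈ Z k ↔ x ∈ Z k := fun k x α =>
    ⟨fun h => by simpa using hZinv k _ (-α) h, hZinv k x α⟩
  refine ⟨fun n => {m | ∃ k, m ∈ M n k ∧ m ∈ Z k ∧ ∀ j < k, m ∉ Z j}, ?_, ?_, ?_⟩
  · intro n
    simp only [Set.ofPred_exists, Set.ofPred_forall, Set.ofPred_and]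
    exact MeasurableSet.iUnion fun k => (hM n k).inter ((hZ k).inter
      (MeasurableSet.iInter fun j => MeasurableSet.iInter fun _ => (hZ j).compl))
  · rintro n x ⟨k, hk1, hk2, hk3⟩ y ⟨k', hk1', hk2', hk3'⟩ hxy
    obtain ⟨γ, hγ, rfl⟩ := id hxy
    have hkk : k = k' := by
      rcases lt_trichotomy k k' with h | h | h
      · exact absurd (hZinv k x γ hk2) (hk3' k h)
      · exact h
      · exact absurd ((hZinv' k' x γ).1 hk2') (hk3 k' h)
    subst hkk
    exact hsep n k x hk1 _ hk1' hxy
  · intro x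
    have hex : ∃ k, x ∈ Z k := by
      choose k m hm hxm using fun n => hcov n x
      obtain ⟨k₀, hk₀⟩ := Finite.exists_infinite_fiber k
      rw [Set.infinite_coe_iff] at hk₀
      refine ⟨k₀, 0, fun N => ?_⟩
      obtain ⟨n, hn, hNn⟩ := hk₀.exists_gt N
      obtain ⟨δ, hδ, h⟩ := hxm n
      refine ⟨n, hNn.le, δ, hδ, ?_⟩
      rw [zero_vadd, h, ← show k n = k₀ from hn]
      exact hm n
    obtain ⟨k, hk, hmin⟩ := wellFounded_lt.has_min {k | x ∈ Z k} hex
    obtain ⟨γ, h⟩ := id hk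
    -- From scale `N` on, the displacement `γ` is absorbed by one more radius `r n`; hence the
    -- factor two.
    obtain ⟨N, hN⟩ := exists_mem_box γ
    obtain ⟨n, hn, δ, hδ, h⟩ := h N
    refine ⟨n, δ +ᵥ γ +ᵥ x, ⟨k, h, hZinv _ _ _ (hZinv _ _ _ hk), fun j hj hj' => ?_⟩, ?_⟩
    · rw [hZinv', hZinv'] at hj'
      exact hmin j hj' hj
    · have h1 : Near d (r n) x (γ +ᵥ x) := ⟨γ, box_mono ((by exact_mod_cast hn : (N : ℤ) ≤ (n : ℤ)).trans
        (hrn n)) hN, rfl⟩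
      have h2 : Near d (r n) (γ +ᵥ x) (δ +ᵥ γ +ᵥ x) := ⟨δ, hδ, rfl⟩
      exact (h1.trans h2).symm.mono (by omega)

end Markers

/-! ### Laminar families and saturation. -/

section Saturation

variable {X : Type*}

/-- A family of sets is laminar if any two of its members are nested or disjoint. -/
def IsLaminar (L : Set (Set X)) : Prop := ∀ U ∈ L, ∀ V ∈ L, U ⊆ V ∨ V ⊆ U ∨ Disjoint U V

/-- The union of `C` and of the members of `L` that meet `C`. -/
def sat (L : Set (Set X)) (C : Set X) : Set X := {x | x ∈ C ∨ ∃ U ∈ L, x ∈ U ∧ ∃ y ∈ U, y ∈ C}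

/-- By laminarity one round of adding members is enough: a member meeting an added member is nested
with it, so it is either already included or itself meets `C`. -/
theorem subset_sat_of_mem {L : Set (Set X)} (hL : IsLaminar L) {C U : Set X} (hU : U ∈ L) {x : X}
    (hx : x ∈ U) (hxC : x ∈ sat L C) : U ⊆ sat L C := by
  intro z hz
  rcases hxC with hxC | ⟨V, hV, hxV, y, hyV, hyC⟩
  · exact Or.inr ⟨U, hU, hz, x, hx, hxC⟩
  · rcases hL U hU V hV with h | h | h
    · exact Or.inr ⟨V, hV, h hz, y, hyV, hyC⟩
    · exact Or.inr ⟨U, hU, hz, y, h hyV, hyC⟩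
    · exact (Set.disjoint_left.1 h hx hxV).elim

end Saturation

/-! ### Construction of the toast. -/

section Toast

variable {d : ℕ} {X : Type*} [AddAction (Fin d → ℤ) X]

variable (d) in
/-- The set of points at distance at most one from `C`. -/
def nbhd (C : Set X) : Set X := {y | ∃ x ∈ C, Near d 1 x y}

variable (d) in
/-- The ball of radius `R` around `m` in its orbit. -/
def ball (R : ℤ) (m : X) : Set X := {x | Near d R m x}

variable (d) in
/-- A saturated set containing the neighbourhood of `sat L C`. -/
def hull (L : Set (Set X)) (C : Set X) : Set X := sat L (nbhd d (sat L C))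

/-- A bound for the diameters of the sets of the hierarchy constructed before stage `n`. -/
def diamBound : ℕ → ℤ
  | 0 => 0
  | n + 1 => 6 * (2 * diamBound n + 1)

/-- The scale of the markers used at stage `n`. -/
def scale (n : ℕ) : ℤ := 2 * diamBound n + 1

theorem le_diamBound (n : ℕ) : (n : ℤ) ≤ diamBound n := by
  induction n with
  | zero => simp [diamBound]
  | succ n ih => simp only [diamBound]; push_cast; omega

variable (d) in
/-- The hierarchy of hulls around the markers of the stages before `n`. -/
def hierarchy (M : ℕ → Set X) : ℕ → Set (Set X)
  | 0 => ∅
  | n + 1 => hierarchy M n ∪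
      {U | ∃ m ∈ M n, U = hull d (hierarchy M n) (ball d (2 * scale n) m)}

variable (d) in
/-- The piece around the marker `m` of stage `n`. -/
def piece (M : ℕ → Set X) (n : ℕ) (m : X) : Set X :=
  {x | m ∈ M n ∧ x ∈ sat (hierarchy d M n) (ball d (2 * scale n) m)}

theorem sat_subset_ball {L : Set (Set X)} {D R : ℤ} (hD : 0 ≤ D)
    (hL : ∀ U ∈ L, ∀ x ∈ U, ∀ y ∈ U, Near d D x y) {C : Set X} {m : X} (hC : C ⊆ ball d R m) :
    sat L C ⊆ ball d (R + D) m := by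
  rintro x (hx | ⟨U, hU, hxU, y, hyU, hyC⟩)
  · exact (hC hx).mono (by omega)
  · exact (hC hyC).trans (hL U hU y hyU x hxU)

theorem nbhd_subset_ball {R : ℤ} {C : Set X} {m : X} (hC : C ⊆ ball d R m) :
    nbhd d C ⊆ ball d (R + 1) m := by
  rintro y ⟨x, hx, hxy⟩
  exact (hC hx).trans hxy

theorem hull_subset_ball {L : Set (Set X)} {D R : ℤ} (hD : 0 ≤ D)
    (hL : ∀ U ∈ L, ∀ x ∈ U, ∀ y ∈ U, Near d D x y) {C : Set X} {m : X} (hC : C ⊆ ball d R m) :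
    hull d L C ⊆ ball d (R + D + 1 + D) m :=
  sat_subset_ball hD hL (nbhd_subset_ball (sat_subset_ball hD hL hC))

theorem diamBound_nonneg (n : ℕ) : 0 ≤ diamBound n := by
  have := le_diamBound n
  omega

/-- With `D = diamBound n` and `s = scale n = 2 * D + 1`, a new hull has radius at most `2 * s + D +
1 + D = 3 * s`, so its diameter is at most `6 * s = diamBound (n + 1)`. -/
theorem near_of_mem_hierarchy (M : ℕ → Set X) (n : ℕ) :
    ∀ U ∈ hierarchy d M n, ∀ x ∈ U, ∀ y ∈ U, Near d (diamBound n) x y := by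
  induction n with
  | zero => exact fun U hU => hU.elim
  | succ n ih =>
    have h0 := diamBound_nonneg n
    rintro U (hU | ⟨m, -, rfl⟩) x hx y hy
    · exact (ih U hU x hx y hy).mono (by simp only [diamBound]; omega)
    · have hx' := hull_subset_ball h0 ih (le_refl (ball d _ m)) hx
      have hy' := hull_subset_ball h0 ih (le_refl (ball d _ m)) hy
      exact (hx'.symm.trans hy').mono (by simp only [diamBound, scale]; omega)

/-- The hulls have radius at most `3 * scale n`, while distinct markers are `6 * scale n`-separated.
-/
theorem disjoint_hull {M : ℕ → Set X} {n : ℕ}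
    (hM : ∀ x ∈ M n, ∀ y ∈ M n, Near d (6 * scale n) x y → x = y) {m m' : X} (hm : m ∈ M n)
    (hm' : m' ∈ M n) (hne : m ≠ m') :
    Disjoint (hull d (hierarchy d M n) (ball d (2 * scale n) m))
      (hull d (hierarchy d M n) (ball d (2 * scale n) m')) := by
  rw [Set.disjoint_left]
  intro x hx hx'
  have h0 := diamBound_nonneg n
  have hL := near_of_mem_hierarchy (d := d) M n
  have h1 := hull_subset_ball h0 hL (le_refl (ball d _ m)) hx
  have h2 := hull_subset_ball h0 hL (le_refl (ball d _ m')) hx'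
  exact hne (hM m hm m' hm' ((h1.trans h2.symm).mono (by simp only [scale]; omega)))

/-- Each hull is a saturation with respect to the earlier members, so it contains or misses each of
them; hulls of the same stage are disjoint. -/
theorem isLaminar_hierarchy {M : ℕ → Set X}
    (hM : ∀ n, ∀ x ∈ M n, ∀ y ∈ M n, Near d (6 * scale n) x y → x = y) (n : ℕ) :
    IsLaminar (hierarchy d M n) := by
  induction n with
  | zero => exact fun U hU => hU.elim
  | succ n ih =>
    have key : ∀ U ∈ hierarchy d M n, ∀ C : Set X, U ⊆ sat (hierarchy d M n) C ∨
        Disjoint U (sat (hierarchy d M n) C) := by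
      intro U hU C
      rw [or_iff_not_imp_right, Set.not_disjoint_iff]
      rintro ⟨x, hx, hxC⟩
      exact subset_sat_of_mem ih hU hx hxC
    rintro U (hU | ⟨m, hm, rfl⟩) V (hV | ⟨m', hm', rfl⟩)
    · exact ih U hU V hV
    · rcases key U hU (nbhd d (sat (hierarchy d M n) (ball d (2 * scale n) m'))) with h | h
      · exact Or.inl h
      · exact Or.inr (Or.inr h)
    · rcases key V hV (nbhd d (sat (hierarchy d M n) (ball d (2 * scale n) m))) with h | h
      · exact Or.inr (Or.inl h)
      · exact Or.inr (Or.inr h.symm)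
    · by_cases h : m = m'
      · subst h
        exact Or.inl le_rfl
      · exact Or.inr (Or.inr (disjoint_hull (hM n) hm hm' h))

theorem hierarchy_mono (M : ℕ → Set X) : Monotone (hierarchy d M) :=
  monotone_nat_of_le_succ fun _ => Set.subset_union_left

/-- A triple of points crosses `A` if it meets both `A` and its complement. -/
def Crosses (A : Set X) (x y z : X) : Prop :=
  (x ∈ A ∨ y ∈ A ∨ z ∈ A) ∧ ¬ (x ∈ A ∧ y ∈ A ∧ z ∈ A)

/-- A triangle that crosses the piece of a marker lies in the hull of the marker. -/
theorem mem_hull_of_crosses {M : ℕ → Set X} {n : ℕ} {m x y z : X} (hxy : Near d 1 x y)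
    (hyz : Near d 1 y z) (hxz : Near d 1 x z) (h : Crosses (piece d M n m) x y z) :
    m ∈ M n ∧ ∀ w, w = x ∨ w = y ∨ w = z →
      w ∈ hull d (hierarchy d M n) (ball d (2 * scale n) m) := by
  have key : ∀ v, v ∈ piece d M n m → ∀ w, Near d 1 v w → m ∈ M n ∧
      w ∈ hull d (hierarchy d M n) (ball d (2 * scale n) m) :=
    fun v hv w hvw => ⟨hv.1, Or.inl ⟨v, hv.2, hvw⟩⟩
  have h0 : ∀ x : X, Near d 1 x x := Near.refl zero_le_one
  rcases h.1 with h1 | h1 | h1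
  · refine ⟨h1.1, ?_⟩
    rintro w (rfl | rfl | rfl)
    · exact (key w h1 w (h0 w)).2
    · exact (key x h1 w hxy).2
    · exact (key x h1 w hxz).2
  · refine ⟨h1.1, ?_⟩
    rintro w (rfl | rfl | rfl)
    · exact (key y h1 w hxy.symm).2
    · exact (key w h1 w (h0 w)).2
    · exact (key y h1 w hyz).2
  · refine ⟨h1.1, ?_⟩
    rintro w (rfl | rfl | rfl)
    · exact (key z h1 w hxz.symm).2
    · exact (key z h1 w hyz.symm).2
    · exact (key w h1 w (h0 w)).2

/-- A triangle crossing the earlier piece lies inside its hull. The later piece is saturated with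
respect to that hull, so it contains or misses the whole triangle. This is why hulls, and not the
pieces themselves, enter the hierarchy. -/
theorem not_crosses_of_lt {M : ℕ → Set X}
    (hM : ∀ n, ∀ x ∈ M n, ∀ y ∈ M n, Near d (6 * scale n) x y → x = y) {n n' : ℕ} (hn : n < n')
    {m m' x y z : X} (hxy : Near d 1 x y) (hyz : Near d 1 y z) (hxz : Near d 1 x z)
    (h : Crosses (piece d M n m) x y z) : ¬ Crosses (piece d M n' m') x y z := by
  intro h'
  obtain ⟨hm, hw⟩ := mem_hull_of_crosses hxy hyz hxz h
  obtain ⟨hm', -⟩ := mem_hull_of_crosses hxy hyz hxz h'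
  have hU : hull d (hierarchy d M n) (ball d (2 * scale n) m) ∈ hierarchy d M n' :=
    hierarchy_mono M (Nat.succ_le_of_lt hn) (Or.inr ⟨m, hm, rfl⟩)
  have key : ∀ v, (v = x ∨ v = y ∨ v = z) → v ∈ piece d M n' m' →
      x ∈ piece d M n' m' ∧ y ∈ piece d M n' m' ∧ z ∈ piece d M n' m' := by
    intro v hv hv'
    have := subset_sat_of_mem (isLaminar_hierarchy hM n') hU (hw v hv) hv'.2
    exact ⟨⟨hm', this (hw x (by simp))⟩, ⟨hm', this (hw y (by simp))⟩,
      ⟨hm', this (hw z (by simp))⟩⟩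
  rcases h'.1 with h1 | h1 | h1
  · exact h'.2 (key x (by simp) h1)
  · exact h'.2 (key y (by simp) h1)
  · exact h'.2 (key z (by simp) h1)

theorem eq_of_crosses {M : ℕ → Set X}
    (hM : ∀ n, ∀ x ∈ M n, ∀ y ∈ M n, Near d (6 * scale n) x y → x = y) {n n' : ℕ}
    {m m' x y z : X} (hxy : Near d 1 x y) (hyz : Near d 1 y z) (hxz : Near d 1 x z)
    (h : Crosses (piece d M n m) x y z) (h' : Crosses (piece d M n' m') x y z) :
    n = n' ∧ m = m' := by
  rcases lt_trichotomy n n' with hn | hn | hn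
  · exact absurd h' (not_crosses_of_lt hM hn hxy hyz hxz h)
  · subst hn
    refine ⟨rfl, ?_⟩
    by_contra hne
    obtain ⟨hm, hw⟩ := mem_hull_of_crosses hxy hyz hxz h
    obtain ⟨hm', hw'⟩ := mem_hull_of_crosses hxy hyz hxz h'
    exact Set.disjoint_left.1 (disjoint_hull (hM n) hm hm' hne) (hw x (by simp)) (hw' x (by simp))
  · exact absurd h (not_crosses_of_lt hM hn hxy hyz hxz h')

theorem piece_subset_ball (M : ℕ → Set X) (n : ℕ) (m : X) :
    piece d M n m ⊆ ball d (2 * scale n + diamBound n) m := fun _ hx =>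
  sat_subset_ball (diamBound_nonneg n) (near_of_mem_hierarchy M n) le_rfl hx.2

variable [MeasurableSpace X]

theorem measurableSet_nbhd {C : X → Set X}
    (hC : ∀ γ : Fin d → ℤ, MeasurableSet {m | γ +ᵥ m ∈ C m}) (γ : Fin d → ℤ) :
    MeasurableSet {m | γ +ᵥ m ∈ nbhd d (C m)} := by
  have h : {m | γ +ᵥ m ∈ nbhd d (C m)} = ⋃ β ∈ box d 1, {m | (β + γ) +ᵥ m ∈ C m} := by
    ext m
    simp only [nbhd, Set.mem_ofPred_eq, Set.mem_iUnion, exists_prop]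
    constructor
    · rintro ⟨x, hx, hxγ⟩
      obtain ⟨β, hβ, rfl⟩ := hxγ.symm
      exact ⟨β, hβ, by rwa [add_vadd]⟩
    · rintro ⟨β, hβ, h⟩
      exact ⟨_, h, Near.symm ⟨β, hβ, by rw [add_vadd]⟩⟩
  rw [h]
  exact MeasurableSet.iUnion fun β => MeasurableSet.iUnion fun _ => hC _

theorem measurableSet_ball (hfree : IsFreeAction d X) (R : ℤ) (γ : Fin d → ℤ) :
    MeasurableSet {m : X | γ +ᵥ m ∈ ball d R m} := by
  have h : ∀ m : X, γ +ᵥ m ∈ ball d R m ↔ γ ∈ box d R := by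
    intro m
    have := hfree.near_vadd_iff (R := R) (x := m) (α := 0) (β := γ)
    rwa [zero_vadd, sub_zero] at this
  simp only [h]
  exact MeasurableSet.const _

variable [MeasurableConstVAdd (Fin d → ℤ) X]

/-- Members of `L` stay within one orbit, so the quantifiers over members and points reduce to a
countable union over group elements. -/
theorem measurableSet_sat {L : Set (Set X)} {D : ℤ}
    (hL : ∀ U ∈ L, ∀ x ∈ U, ∀ y ∈ U, Near d D x y)
    (hLm : ∀ β : Fin d → ℤ, MeasurableSet {x | ∃ U ∈ L, x ∈ U ∧ β +ᵥ x ∈ U}) {C : X → Set X}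
    (hC : ∀ γ : Fin d → ℤ, MeasurableSet {m | γ +ᵥ m ∈ C m}) (γ : Fin d → ℤ) :
    MeasurableSet {m | γ +ᵥ m ∈ sat L (C m)} := by
  have h : {m | γ +ᵥ m ∈ sat L (C m)} = {m | γ +ᵥ m ∈ C m} ∪
      ⋃ β : Fin d → ℤ, {m | γ +ᵥ m ∈ {x | ∃ U ∈ L, x ∈ U ∧ β +ᵥ x ∈ U}} ∩
        {m | (β + γ) +ᵥ m ∈ C m} := by
    ext m
    simp only [sat, Set.mem_ofPred_eq, Set.mem_union, Set.mem_iUnion, Set.mem_inter_iff]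
    refine or_congr Iff.rfl ?_
    constructor
    · rintro ⟨U, hU, hm, y, hyU, hyC⟩
      obtain ⟨β, -, rfl⟩ := hL U hU _ hm _ hyU
      exact ⟨β, ⟨U, hU, hm, hyU⟩, by rwa [add_vadd]⟩
    · rintro ⟨β, ⟨U, hU, hm, hβ⟩, hC⟩
      exact ⟨U, hU, hm, _, hβ, by rwa [add_vadd] at hC⟩
  rw [h]
  exact (hC γ).union (MeasurableSet.iUnion fun β => (measurableSet_vadd (hLm β) γ).inter (hC _))

theorem measurableSet_hierarchy (hfree : IsFreeAction d X) {M : ℕ → Set X}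
    (hM : ∀ n, MeasurableSet (M n)) (n : ℕ) (β : Fin d → ℤ) :
    MeasurableSet {x | ∃ U ∈ hierarchy d M n, x ∈ U ∧ β +ᵥ x ∈ U} := by
  induction n generalizing β with
  | zero => simp [hierarchy]
  | succ n ih =>
    have hL := near_of_mem_hierarchy (d := d) M n
    have hH : ∀ γ : Fin d → ℤ, MeasurableSet
        {m | γ +ᵥ m ∈ hull d (hierarchy d M n) (ball d (2 * scale n) m)} :=
      measurableSet_sat hL ih (measurableSet_nbhd
        (measurableSet_sat hL ih (measurableSet_ball hfree _)))
    have h : {x | ∃ U ∈ hierarchy d M (n + 1), x ∈ U ∧ β +ᵥ x ∈ U} =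
        {x | ∃ U ∈ hierarchy d M n, x ∈ U ∧ β +ᵥ x ∈ U} ∪ ⋃ δ : Fin d → ℤ,
          {x | δ +ᵥ x ∈ M n ∩
            {m | -δ +ᵥ m ∈ hull d (hierarchy d M n) (ball d (2 * scale n) m)} ∩
            {m | (β - δ) +ᵥ m ∈ hull d (hierarchy d M n) (ball d (2 * scale n) m)}} := by
      ext x
      simp only [hierarchy, Set.mem_ofPred_eq, Set.mem_union, Set.mem_iUnion, Set.mem_inter_iff,
        ← add_vadd, sub_add_cancel, neg_add_cancel, zero_vadd]
      constructor
      · rintro ⟨U, hU | ⟨m, hm, rfl⟩, hx, hβ⟩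
        · exact Or.inl ⟨U, hU, hx, hβ⟩
        · have := hull_subset_ball (diamBound_nonneg n) hL (le_refl (ball d _ m)) hx
          obtain ⟨δ, -, rfl⟩ := Near.symm this
          exact Or.inr ⟨δ, ⟨hm, hx⟩, hβ⟩
      · rintro (⟨U, hU, hx, hβ⟩ | ⟨δ, ⟨hm, hx⟩, hβ⟩)
        · exact ⟨U, Or.inl hU, hx, hβ⟩
        · exact ⟨_, Or.inr ⟨_, hm, rfl⟩, hx, hβ⟩
    rw [h]
    exact (ih β).union (MeasurableSet.iUnion fun δ =>
      measurableSet_vadd (((hM n).inter (hH _)).inter (hH _)) δ)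

/-- A Borel family of finite sets `A n m`, each contained in the orbit of `m`, that covers the space
and such that no triangle crosses two members of the family. -/
structure IsToast (d : ℕ) {X : Type*} [MeasurableSpace X] [AddAction (Fin d → ℤ) X]
    (A : ℕ → X → Set X) : Prop where
  near : ∀ n, ∃ R, ∀ m, ∀ x ∈ A n m, Near d R m x
  measurableSet : ∀ n, ∀ γ : Fin d → ℤ, MeasurableSet {m | γ +ᵥ m ∈ A n m}
  cover : ∀ x, ∃ n m, x ∈ A n m
  eq_of_crosses : ∀ n m n' m' x y z, Near d 1 x y → Near d 1 y z → Near d 1 x z →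
    Crosses (A n m) x y z → Crosses (A n' m') x y z → n = n' ∧ m = m'

theorem exists_toast [StandardBorelSpace X] (hfree : IsFreeAction d X) :
    ∃ A : ℕ → X → Set X, IsToast d A := by
  obtain ⟨M, hM, hsep, hcov⟩ := exists_markers hfree scale
    (fun n => by have := diamBound_nonneg n; simp only [scale]; omega)
    (fun n => by have := le_diamBound n; simp only [scale]; omega)
  refine ⟨piece d M, fun n => ⟨_, piece_subset_ball M n⟩, fun n γ => ?_, fun x => ?_, ?_⟩
  · exact (hM n).inter (measurableSet_sat (near_of_mem_hierarchy M n)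
      (measurableSet_hierarchy hfree hM n) (measurableSet_ball hfree _) γ)
  · obtain ⟨n, m, hm, h⟩ := hcov x
    exact ⟨n, m, hm, Or.inl h⟩
  · exact fun n m n' m' x y z hxy hyz hxz h h' => eq_of_crosses hsep hxy hyz hxz h h'

end Toast

/-! ### Reduction of coefficients modulo one. -/

section OddFract

/-- The odd extension of the fractional part of nonnegative numbers. -/
noncomputable def oddFract (r : ℝ) : ℝ := if 0 ≤ r then Int.fract r else - Int.fract (-r)

theorem oddFract_zero : oddFract 0 = 0 := by simp [oddFract]

/-- Oddness, which the usual fractional part lacks, keeps alternating chains alternating after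
reduction. -/
theorem oddFract_neg (r : ℝ) : oddFract (-r) = - oddFract r := by
  unfold oddFract
  rcases lt_trichotomy r 0 with h | rfl | h
  · rw [if_pos (by linarith), if_neg (by linarith), neg_neg]
  · simp
  · rw [if_neg (by linarith), if_pos h.le, neg_neg]

theorem abs_oddFract_le_one (r : ℝ) : |oddFract r| ≤ 1 := by
  unfold oddFract
  split_ifs
  · rw [abs_of_nonneg (Int.fract_nonneg _)]
    exact (Int.fract_lt_one _).le
  · rw [abs_neg, abs_of_nonneg (Int.fract_nonneg _)]
    exact (Int.fract_lt_one _).le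

theorem oddFract_sub_mem_integers (r : ℝ) : oddFract r - r ∈ integers := by
  unfold oddFract
  split_ifs
  · exact mem_integers.2 ⟨-⌊r⌋, by rw [Int.fract]; push_cast; ring⟩
  · exact mem_integers.2 ⟨⌊-r⌋, by rw [Int.fract]; ring⟩

theorem measurable_oddFract : Measurable oddFract :=
  Measurable.ite measurableSet_Ici measurable_fract
    ((measurable_fract.comp measurable_neg).neg)

end OddFract

theorem measurable_of_cover {ι X β : Type*} [Countable ι] [MeasurableSpace X] [MeasurableSpace β]
    {f : X → β} {s : ι → Set X} {h : ι → X → β} (hs : ∀ i, MeasurableSet (s i))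
    (hh : ∀ i, Measurable (h i)) (hcov : ∀ x, ∃ i, x ∈ s i)
    (heq : ∀ i, ∀ x ∈ s i, f x = h i x) : Measurable f := by
  intro t ht
  have : f ⁻¹' t = ⋃ i, s i ∩ h i ⁻¹' t := by
    ext x
    simp only [Set.mem_preimage, Set.mem_iUnion, Set.mem_inter_iff]
    constructor
    · intro hx
      obtain ⟨i, hi⟩ := hcov x
      exact ⟨i, hi, by rwa [← heq i x hi]⟩
    · rintro ⟨i, hi, hx⟩
      rwa [heq i x hi]
  rw [this]
  exact MeasurableSet.iUnion fun i => (hs i).inter (hh i ht)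

/-! ### Correcting the flow along triangles that cross the toast. -/

section Chain

variable {d : ℕ} {X : Type*} [AddAction (Fin d → ℤ) X]

open Classical in
/-- The coordinates with respect to `m` of the points of `C`. -/
noncomputable def trace (d : ℕ) {X : Type*} [AddAction (Fin d → ℤ) X] (C : Set X) (m : X) :
    Finset (Fin d → ℤ) :=
  if h : {γ : Fin d → ℤ | γ +ᵥ m ∈ C}.Finite then h.toFinset else ∅

theorem Crosses.swap₁₂ {A : Set X} {x y z : X} (h : Crosses A x y z) : Crosses A y x z := by
  unfold Crosses at h ⊢
  tauto

theorem Crosses.swap₂₃ {A : Set X} {x y z : X} (h : Crosses A x y z) : Crosses A x z y := by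
  unfold Crosses at h ⊢
  tauto

/-- The boundary chain of `S`, placed at `m`, that makes `F` integral on the boundary of `S`. -/
noncomputable def chainAt (K : Finset (Fin d → ℤ) → (Fin d → ℤ) × (Fin d → ℤ) →
    (Fin d → ℤ) → (Fin d → ℤ) → (Fin d → ℤ) → ℤ) (F : X → X → ℝ) (S : Finset (Fin d → ℤ)) (m : X)
    (α β γ : Fin d → ℤ) : ℝ :=
  ∑ e ∈ bdry S, F (e.1 +ᵥ m) (e.2 +ᵥ m) * K S e α β γ

/-- The triangle `x, y, z` crosses the set `A n m`, and `α, β, γ` are its coordinates with respect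
to `m`. -/
structure IsAddress (d : ℕ) {X : Type*} [AddAction (Fin d → ℤ) X] (A : ℕ → X → Set X)
    (p : ℕ × X × (Fin d → ℤ) × (Fin d → ℤ) × (Fin d → ℤ)) (x y z : X) : Prop where
  fst : p.2.2.1 +ᵥ p.2.1 = x
  snd : p.2.2.2.1 +ᵥ p.2.1 = y
  thd : p.2.2.2.2 +ᵥ p.2.1 = z
  near₁₂ : Near d 1 x y
  near₂₃ : Near d 1 y z
  near₁₃ : Near d 1 x z
  crosses : Crosses (A p.1 p.2.1) x y z

open Classical in
/-- The chain of triangles assembled from the boundary chains of the members of a toast, reduced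
modulo one. -/
noncomputable def toastChain (K : Finset (Fin d → ℤ) → (Fin d → ℤ) × (Fin d → ℤ) →
    (Fin d → ℤ) → (Fin d → ℤ) → (Fin d → ℤ) → ℤ) (F : X → X → ℝ) (A : ℕ → X → Set X)
    (x y z : X) : ℝ :=
  if h : ∃ p, IsAddress d A p x y z then
    oddFract (chainAt K F (trace d (A h.choose.1 h.choose.2.1) h.choose.2.1) h.choose.2.1
      h.choose.2.2.1 h.choose.2.2.2.1 h.choose.2.2.2.2)
  else 0

variable {A : ℕ → X → Set X} {F : X → X → ℝ} {K : Finset (Fin d → ℤ) → (Fin d → ℤ) × (Fin d → ℤ) →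
    (Fin d → ℤ) → (Fin d → ℤ) → (Fin d → ℤ) → ℤ}

theorem toastChain_eq_zero {x y z : X} (h : ¬ ∃ p, IsAddress d A p x y z) :
    toastChain K F A x y z = 0 := by
  rw [toastChain, dif_neg h]

theorem abs_toastChain_le (x y z : X) : |toastChain K F A x y z| ≤ 1 := by
  unfold toastChain
  split_ifs
  · exact abs_oddFract_le_one _
  · simp

theorem near_of_toastChain_ne_zero {x y z : X} (h : toastChain K F A x y z ≠ 0) :
    Near d 1 x y ∧ Near d 1 y z ∧ Near d 1 x z := by
  by_cases hex : ∃ p, IsAddress d A p x y z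
  · obtain ⟨p, hp⟩ := hex
    exact ⟨hp.near₁₂, hp.near₂₃, hp.near₁₃⟩
  · exact absurd (toastChain_eq_zero hex) h

theorem IsAddress.swap₁₂ {n : ℕ} {m : X} {α β γ : Fin d → ℤ} {x y z : X}
    (h : IsAddress d A (n, m, α, β, γ) x y z) : IsAddress d A (n, m, β, α, γ) y x z :=
  ⟨h.snd, h.fst, h.thd, h.near₁₂.symm, h.near₁₃, h.near₂₃, h.crosses.swap₁₂⟩

theorem IsAddress.swap₂₃ {n : ℕ} {m : X} {α β γ : Fin d → ℤ} {x y z : X}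
    (h : IsAddress d A (n, m, α, β, γ) x y z) : IsAddress d A (n, m, α, γ, β) x z y :=
  ⟨h.fst, h.thd, h.snd, h.near₁₃, h.near₂₃.symm, h.near₁₂, h.crosses.swap₂₃⟩

variable [MeasurableSpace X]

variable (d) in
/-- An antisymmetric function on the edges of the graph of the action, extended by zero, that is
Borel and has integer divergence. -/
structure IsBorelFlow (F : X → X → ℝ) : Prop where
  antisymm : ∀ x y, F x y = - F y x
  near : ∀ x y, F x y ≠ 0 → Near d 1 x y
  measurable : ∀ γ : Fin d → ℤ, Measurable fun x => F x (γ +ᵥ x)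
  sum_mem : ∀ x, ∑ γ ∈ box d 1, F x (γ +ᵥ x) ∈ integers

namespace IsToast

theorem mem_trace (hA : IsToast d A) (hfree : IsFreeAction d X) {n : ℕ} {m : X}
    {γ : Fin d → ℤ} : γ ∈ trace d (A n m) m ↔ γ +ᵥ m ∈ A n m := by
  have h : {γ : Fin d → ℤ | γ +ᵥ m ∈ A n m}.Finite := by
    obtain ⟨R, hR⟩ := hA.near n
    refine (box d R).finite_toSet.subset fun γ hγ => ?_
    obtain ⟨δ, hδ, h⟩ := hR m _ hγ
    rw [← hfree.vadd_injective m h]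
    exact hδ
  rw [trace, dif_pos h, Set.Finite.mem_toFinset]
  rfl

theorem measurableSet_trace_eq (hA : IsToast d A) (hfree : IsFreeAction d X) (n : ℕ)
    (S : Finset (Fin d → ℤ)) : MeasurableSet {m | trace d (A n m) m = S} := by
  have h : {m | trace d (A n m) m = S} =
      ⋂ γ : Fin d → ℤ, {m | γ +ᵥ m ∈ A n m ↔ γ ∈ S} := by
    ext m
    simp only [Set.mem_ofPred_eq, Set.mem_iInter, Finset.ext_iff, hA.mem_trace hfree]
  rw [h]
  refine MeasurableSet.iInter fun γ => ?_
  by_cases hγ : γ ∈ S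
  · simpa only [hγ, iff_true] using hA.measurableSet n γ
  · simp only [hγ, iff_false]
    exact (hA.measurableSet n γ).compl

variable [MeasurableConstVAdd (Fin d → ℤ) X]

theorem measurableSet_mem (hA : IsToast d A) (n : ℕ) (α δ : Fin d → ℤ) :
    MeasurableSet {x | α +ᵥ x ∈ A n (δ +ᵥ x)} := by
  have := measurableSet_vadd (hA.measurableSet n (α - δ)) δ
  simpa only [Set.mem_ofPred_eq, ← add_vadd, sub_add_cancel] using this

end IsToast

theorem IsBorelFlow.measurable_vadd [MeasurableConstVAdd (Fin d → ℤ) X] {F : X → X → ℝ}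
    (hF : IsBorelFlow d F) (α β : Fin d → ℤ) : Measurable fun x => F (α +ᵥ x) (β +ᵥ x) := by
  have := (hF.measurable (β - α)).comp (measurable_const_vadd (M := Fin d → ℤ) (α := X) α)
  simpa only [Function.comp_def, ← add_vadd, sub_add_cancel] using this

/-- The toast property determines the member that is crossed and freeness determines the
coordinates, so the choice made in `toastChain` is immaterial. -/
theorem IsAddress.eq (hA : IsToast d A) (hfree : IsFreeAction d X) {p q} {x y z : X}
    (hp : IsAddress d A p x y z) (hq : IsAddress d A q x y z) : p = q := by
  obtain ⟨n, m, α, β, γ⟩ := p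
  obtain ⟨n', m', α', β', γ'⟩ := q
  obtain ⟨h1, h2⟩ := hA.eq_of_crosses _ _ _ _ _ _ _ hp.near₁₂ hp.near₂₃ hp.near₁₃ hp.crosses
    hq.crosses
  simp only at h1 h2
  subst h1 h2
  have h1 : α = α' := hfree.vadd_injective m (hp.fst.trans hq.fst.symm)
  have h2 : β = β' := hfree.vadd_injective m (hp.snd.trans hq.snd.symm)
  have h3 : γ = γ' := hfree.vadd_injective m (hp.thd.trans hq.thd.symm)
  rw [h1, h2, h3]

theorem toastChain_eq (hA : IsToast d A) (hfree : IsFreeAction d X) {n : ℕ} {m : X}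
    {α β γ : Fin d → ℤ} {x y z : X} (h : IsAddress d A (n, m, α, β, γ) x y z) :
    toastChain K F A x y z = oddFract (chainAt K F (trace d (A n m) m) m α β γ) := by
  have hex : ∃ p, IsAddress d A p x y z := ⟨_, h⟩
  rw [toastChain, dif_pos hex, hex.choose_spec.eq hA hfree h]

theorem toastChain_swap₁₂ (hA : IsToast d A) (hfree : IsFreeAction d X)
    (hK : ∀ S e, IsBdryChain S (K S e)) (x y z : X) :
    toastChain K F A x y z = - toastChain K F A y x z := by
  by_cases h : ∃ p, IsAddress d A p x y z
  · obtain ⟨⟨n, m, α, β, γ⟩, hp⟩ := h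
    rw [toastChain_eq hA hfree hp, toastChain_eq hA hfree hp.swap₁₂, ← oddFract_neg]
    congr 1
    simp only [chainAt, ← Finset.sum_neg_distrib]
    refine Finset.sum_congr rfl fun e _ => ?_
    rw [(hK _ e).swap₁₂ α]
    push_cast
    ring
  · have h' : ¬ ∃ p, IsAddress d A p y x z := fun ⟨_, hp⟩ => h ⟨_, hp.swap₁₂⟩
    rw [toastChain_eq_zero h, toastChain_eq_zero h', neg_zero]

theorem toastChain_swap₂₃ (hA : IsToast d A) (hfree : IsFreeAction d X)
    (hK : ∀ S e, IsBdryChain S (K S e)) (x y z : X) :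
    toastChain K F A x y z = - toastChain K F A x z y := by
  by_cases h : ∃ p, IsAddress d A p x y z
  · obtain ⟨⟨n, m, α, β, γ⟩, hp⟩ := h
    rw [toastChain_eq hA hfree hp, toastChain_eq hA hfree hp.swap₂₃, ← oddFract_neg]
    congr 1
    simp only [chainAt, ← Finset.sum_neg_distrib]
    refine Finset.sum_congr rfl fun e _ => ?_
    rw [(hK _ e).swap₂₃ α]
    push_cast
    ring
  · have h' : ¬ ∃ p, IsAddress d A p x z y := fun ⟨_, hp⟩ => h ⟨_, hp.swap₂₃⟩
    rw [toastChain_eq_zero h, toastChain_eq_zero h', neg_zero]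

/-- Countably many data decide the value: the index `n`, the position `δ` of the marker relative to
`x`, and the shape `S` of the member. For fixed data it is `oddFract` of a finite linear combination
of Borel functions. -/
theorem measurable_toastChain [MeasurableConstVAdd (Fin d → ℤ) X] (hA : IsToast d A)
    (hfree : IsFreeAction d X) (hF : IsBorelFlow d F) (α β : Fin d → ℤ) :
    Measurable fun x => toastChain K F A x (α +ᵥ x) (β +ᵥ x) := by
  by_cases hnear : α ∈ box d 1 ∧ β - α ∈ box d 1 ∧ β ∈ box d 1
  swap
  · have : (fun x => toastChain K F A x (α +ᵥ x) (β +ᵥ x)) = fun _ => 0 := by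
      funext x
      by_contra h
      obtain ⟨h1, h2, h3⟩ := near_of_toastChain_ne_zero h
      apply hnear
      have h0 : x = (0 : Fin d → ℤ) +ᵥ x := (zero_vadd _ x).symm
      rw [h0, ← add_vadd, add_zero, hfree.near_vadd_iff, sub_zero] at h1
      rw [h0, ← add_vadd β, add_zero, hfree.near_vadd_iff, sub_zero] at h3
      exact ⟨h1, hfree.near_vadd_iff.1 h2, h3⟩
    rw [this]
    exact measurable_const
  · let C : ℕ → (Fin d → ℤ) → Set X := fun n δ =>
      {x | Crosses (A n (δ +ᵥ x)) x (α +ᵥ x) (β +ᵥ x)}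
    have hC : ∀ n δ, MeasurableSet (C n δ) := by
      intro n δ
      have h0 : MeasurableSet {x | x ∈ A n (δ +ᵥ x)} := by
        simpa only [zero_vadd] using hA.measurableSet_mem n 0 δ
      have h1 := hA.measurableSet_mem n α δ
      have h2 := hA.measurableSet_mem n β δ
      exact (h0.union (h1.union h2)).inter (h0.inter (h1.inter h2)).compl
    have hadd : ∀ x n δ, x ∈ C n δ →
        IsAddress d A (n, δ +ᵥ x, -δ, α - δ, β - δ) x (α +ᵥ x) (β +ᵥ x) := by
      intro x n δ hx
      refine ⟨neg_vadd_vadd _ _, ?_, ?_, ⟨α, hnear.1, rfl⟩, hfree.near_vadd_iff.2 hnear.2.1,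
        ⟨β, hnear.2.2, rfl⟩, hx⟩
      · simp only [← add_vadd, sub_add_cancel]
      · simp only [← add_vadd, sub_add_cancel]
    let s : Option (ℕ × (Fin d → ℤ) × Finset (Fin d → ℤ)) → Set X := fun i =>
      i.elim (⋃ n, ⋃ δ, C n δ)ᶜ fun p =>
        C p.1 p.2.1 ∩ {x | p.2.1 +ᵥ x ∈ {m | trace d (A p.1 m) m = p.2.2}}
    let h : Option (ℕ × (Fin d → ℤ) × Finset (Fin d → ℤ)) → X → ℝ := fun i =>
      i.elim (fun _ => 0) fun p x => oddFract (chainAt K F p.2.2 (p.2.1 +ᵥ x) (-p.2.1)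
        (α - p.2.1) (β - p.2.1))
    refine measurable_of_cover (s := s) (h := h) ?_ ?_ ?_ ?_
    · rintro (_ | ⟨n, δ, S⟩)
      · exact (MeasurableSet.iUnion fun n => MeasurableSet.iUnion fun δ => hC n δ).compl
      · exact (hC n δ).inter (measurableSet_vadd (hA.measurableSet_trace_eq hfree n S) δ)
    · rintro (_ | ⟨n, δ, S⟩)
      · exact measurable_const
      · refine measurable_oddFract.comp (Finset.measurable_sum _ fun e _ => ?_)
        have := hF.measurable_vadd (e.1 + δ) (e.2 + δ)
        simp only [add_vadd] at this
        exact this.mul_const _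
    · intro x
      by_cases hx : ∃ n δ, x ∈ C n δ
      · obtain ⟨n, δ, hx⟩ := hx
        exact ⟨some (n, δ, trace d (A n (δ +ᵥ x)) (δ +ᵥ x)), hx, rfl⟩
      · exact ⟨none, by simpa [s] using hx⟩
    · rintro (_ | ⟨n, δ, S⟩) x hx
      · refine toastChain_eq_zero ?_
        rintro ⟨⟨n, m, a, b, c⟩, hp⟩
        apply hx
        have h1 : a +ᵥ m = x := hp.fst
        have h2 : m = -a +ᵥ x := by rw [← h1, neg_vadd_vadd]
        have h3 : Crosses (A n m) x (α +ᵥ x) (β +ᵥ x) := hp.crosses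
        rw [h2] at h3
        exact Set.mem_iUnion.2 ⟨n, Set.mem_iUnion.2 ⟨-a, h3⟩⟩
      · obtain ⟨hx1, hx2⟩ := hx
        have hS : trace d (A n (δ +ᵥ x)) (δ +ᵥ x) = S := hx2
        rw [toastChain_eq hA hfree (hadd x n δ hx1), hS]
        rfl

/-- Every triangle on an edge leaving `A n m` crosses `A n m`, so the correction there is the
filling of this one member, up to integers introduced by `oddFract`. -/
theorem add_sum_toastChain_mem_integers (hA : IsToast d A) (hfree : IsFreeAction d X)
    (hF : IsBorelFlow d F) (hK : ∀ S e, IsBdryChain S (K S e))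
    (hfill : ∀ S, ∀ Φ : (Fin d → ℤ) → (Fin d → ℤ) → ℝ, (∀ x y, Φ x y = - Φ y x) →
      (∀ x y, Φ x y ≠ 0 → y - x ∈ box d 1) → (∀ x, ∑ γ ∈ box d 1, Φ x (γ + x) ∈ integers) →
      ∀ p ∈ bdry S, Φ p.1 p.2 +
        ∑ γ ∈ box d 1, ∑ e ∈ bdry S, Φ e.1 e.2 * K S e p.1 p.2 (γ + p.1) ∈ integers)
    {n : ℕ} {m x y : X} (hxy : Near d 1 x y) (hx : x ∈ A n m) (hy : y ∉ A n m) :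
    F x y + ∑ γ ∈ box d 1, toastChain K F A x y (γ +ᵥ x) ∈ integers := by
  obtain ⟨R, hR⟩ := hA.near n
  obtain ⟨a, -, rfl⟩ := hR m x hx
  obtain ⟨δ, hδ, rfl⟩ := id hxy
  set S := trace d (A n m) m with hS
  have key := hfill S (fun α β => F (α +ᵥ m) (β +ᵥ m)) (fun _ _ => hF.antisymm _ _)
    (fun α β h => hfree.near_vadd_iff.1 (hF.near _ _ h))
    (fun α => by simpa only [add_vadd] using hF.sum_mem (α +ᵥ m)) (a, δ + a) (mem_bdry.2
      ⟨(hA.mem_trace hfree).2 hx, fun h => hy (by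
        rw [← add_vadd]; exact (hA.mem_trace hfree).1 h), by simpa using hδ⟩)
  simp only at key
  rw [add_vadd] at key
  have hterm : ∀ γ ∈ box d 1, toastChain K F A (a +ᵥ m) (δ +ᵥ a +ᵥ m) (γ +ᵥ a +ᵥ m) =
      oddFract (chainAt K F S m a (δ + a) (γ + a)) := by
    intro γ hγ
    by_cases hn : Near d 1 (δ +ᵥ a +ᵥ m) (γ +ᵥ a +ᵥ m)
    · exact toastChain_eq hA hfree ⟨rfl, add_vadd _ _ _, add_vadd _ _ _, hxy, hn, ⟨γ, hγ, rfl⟩,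
        Or.inl hx, fun h => hy h.2.1⟩
    · have h0 : chainAt K F S m a (δ + a) (γ + a) = 0 := by
        refine Finset.sum_eq_zero fun e _ => ?_
        have : K S e a (δ + a) (γ + a) = 0 := by
          by_contra h
          apply hn
          rw [← add_vadd, ← add_vadd]
          exact hfree.near_vadd_iff.2 ((hK S e).near₂₃ _ _ _ h)
        rw [this, Int.cast_zero, mul_zero]
      rw [h0, oddFract_zero]
      by_contra h
      exact hn (near_of_toastChain_ne_zero h).2.1
  rw [Finset.sum_congr rfl hterm]
  have h1 : ∑ γ ∈ box d 1, oddFract (chainAt K F S m a (δ + a) (γ + a)) -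
      ∑ γ ∈ box d 1, chainAt K F S m a (δ + a) (γ + a) ∈ integers := by
    rw [← Finset.sum_sub_distrib]
    exact integers.sum_mem fun γ _ => oddFract_sub_mem_integers _
  have h2 := integers.add_mem key h1
  convert h2 using 1
  simp only [chainAt]
  ring

/-- Adding the boundary of a chain of triangles with coefficients at most one makes a Borel flow
integral on all edges that leave a member of a toast. -/
theorem exists_integral_on_boundaries [MeasurableConstVAdd (Fin d → ℤ) X] (hd : 2 ≤ d)
    (hA : IsToast d A) (hfree : IsFreeAction d X) (hF : IsBorelFlow d F) :
    ∃ G : X → X → ℝ, IsBorelFlow d G ∧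
      (∀ x, ∑ γ ∈ box d 1, G x (γ +ᵥ x) = ∑ γ ∈ box d 1, F x (γ +ᵥ x)) ∧
      (∀ x y, |F x y - G x y| ≤ 3 ^ d - 1) ∧
      ∀ n m x y, x ∈ A n m → y ∉ A n m → G x y ∈ integers := by
  choose K hK hfill using exists_filling hd
  have h12 := toastChain_swap₁₂ (F := F) hA hfree hK
  have h23 := toastChain_swap₂₃ (F := F) hA hfree hK
  -- The third vertex of a triangle is near both `x` and `y`, so the sum may be centred at either;
  -- antisymmetry of the boundary follows.
  have hshift : ∀ x y : X, Near d 1 x y → ∑ γ ∈ box d 1, toastChain K F A x y (γ +ᵥ y) =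
      ∑ γ ∈ box d 1, toastChain K F A x y (γ +ᵥ x) := by
    rintro x y ⟨β, hβ, rfl⟩
    refine Finset.sum_bij_ne_zero (fun γ _ _ => γ + β) ?_ ?_ ?_ ?_
    · intro γ _ h
      have := (near_of_toastChain_ne_zero h).2.2
      rw [← add_vadd] at this
      nth_rw 1 [← zero_vadd (Fin d → ℤ) x] at this
      simpa using hfree.near_vadd_iff.1 this
    · intro γ _ _ γ' _ _ h
      exact add_right_cancel h
    · intro γ hγ h
      refine ⟨γ - β, hfree.near_vadd_iff.1 (near_of_toastChain_ne_zero h).2.1, ?_, by simp⟩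
      rwa [← add_vadd, sub_add_cancel]
    · intro γ _ _
      rw [add_vadd]
  have hzero : ∀ x y, ¬ Near d 1 x y → ∀ z, toastChain K F A x y z = 0 := fun x y h z => by
    by_contra h'
    exact h (near_of_toastChain_ne_zero h').1
  have hsum : ∀ x, ∑ γ ∈ box d 1, (F x (γ +ᵥ x) +
      ∑ γ' ∈ box d 1, toastChain K F A x (γ +ᵥ x) (γ' +ᵥ x)) =
      ∑ γ ∈ box d 1, F x (γ +ᵥ x) := by
    intro x
    rw [Finset.sum_add_distrib, sum_sum_eq_zero_of_antisymm (box d 1)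
      (fun γ γ' => toastChain K F A x (γ +ᵥ x) (γ' +ᵥ x)) (fun _ _ => h23 _ _ _), add_zero]
  refine ⟨fun x y => F x y + ∑ γ ∈ box d 1, toastChain K F A x y (γ +ᵥ x), ?_, hsum, ?_, ?_⟩
  · refine ⟨?_, ?_, ?_, ?_⟩
    · intro x y
      by_cases hxy : Near d 1 x y
      · rw [hF.antisymm x y, ← hshift x y hxy, neg_add, ← Finset.sum_neg_distrib]
        congr 1
        exact Finset.sum_congr rfl fun γ _ => h12 _ _ _
      · have hyx : ¬ Near d 1 y x := fun h => hxy h.symm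
        simp only [hzero x y hxy, hzero y x hyx, Finset.sum_const_zero, add_zero]
        exact hF.antisymm x y
    · intro x y h
      by_contra hxy
      apply h
      have : F x y = 0 := by
        by_contra h'
        exact hxy (hF.near x y h')
      simp [this, hzero x y hxy]
    · intro γ
      exact (hF.measurable γ).add (Finset.measurable_sum _ fun γ' _ =>
        measurable_toastChain hA hfree hF γ γ')
    · intro x
      rw [hsum]
      exact hF.sum_mem x
  · intro x y
    rw [sub_add_cancel_left, abs_neg, ← Finset.add_sum_erase _ _ (zero_mem_box zero_le_one)]
    have h0 : toastChain K F A x y ((0 : Fin d → ℤ) +ᵥ x) = 0 := by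
      rw [zero_vadd]
      have h1 := h12 x y x
      have h2 := h23 y x x
      linarith
    rw [h0, zero_add]
    refine (Finset.abs_sum_le_sum_abs _ _).trans ((Finset.sum_le_card_nsmul _ _ 1 fun γ _ =>
      abs_toastChain_le _ _ _).trans ?_)
    rw [Finset.card_erase_of_mem (zero_mem_box zero_le_one), card_box]
    simp
  · intro n m x y hx hy
    by_cases hxy : Near d 1 x y
    · exact add_sum_toastChain_mem_integers hA hfree hF hK hfill hxy hx hy
    · have : F x y = 0 := by
        by_contra h'
        exact hxy (hF.near x y h')
      simp only [this, hzero x y hxy, Finset.sum_const_zero, add_zero]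
      exact integers.zero_mem

end Chain

section Cells

variable {d : ℕ} {X : Type*}

/-- Two points lie in the same cell of `A` if they belong to the same sets `A n m`. -/
def SameCell (A : ℕ → X → Set X) (x y : X) : Prop := ∀ n m, x ∈ A n m ↔ y ∈ A n m

variable {A : ℕ → X → Set X}

theorem SameCell.refl (x : X) : SameCell A x x := fun _ _ => Iff.rfl

theorem SameCell.symm {x y : X} (h : SameCell A x y) : SameCell A y x := fun n m => (h n m).symm

theorem SameCell.trans {x y z : X} (h : SameCell A x y) (h' : SameCell A y z) : SameCell A x z :=
  fun n m => (h n m).trans (h' n m)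

variable [AddAction (Fin d → ℤ) X] [MeasurableSpace X]

theorem IsToast.exists_vadd_eq_of_sameCell (hA : IsToast d A) {x y : X} (h : SameCell A x y) :
    ∃ γ : Fin d → ℤ, γ +ᵥ x = y := by
  obtain ⟨n, m, hm⟩ := hA.cover x
  obtain ⟨R, hR⟩ := hA.near n
  obtain ⟨γ, -, h⟩ := (hR m x hm).symm.trans (hR m y ((h n m).1 hm))
  exact ⟨γ, h⟩

theorem IsToast.finite_sameCell (hA : IsToast d A) (hfree : IsFreeAction d X) (x : X) :
    {γ : Fin d → ℤ | SameCell A x (γ +ᵥ x)}.Finite := by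
  obtain ⟨n, m, hm⟩ := hA.cover x
  obtain ⟨R, hR⟩ := hA.near n
  refine (box d (R + R)).finite_toSet.subset fun γ hγ => ?_
  obtain ⟨δ, hδ, h⟩ := (hR m x hm).symm.trans (hR m _ ((hγ n m).1 hm))
  rw [← hfree.vadd_injective x h]
  exact hδ

/-- The coordinates with respect to `x` of the points in the cell of `x`. -/
noncomputable def IsToast.cell (hA : IsToast d A) (hfree : IsFreeAction d X) (x : X) :
    Finset (Fin d → ℤ) := (hA.finite_sameCell hfree x).toFinset

theorem IsToast.mem_cell (hA : IsToast d A) (hfree : IsFreeAction d X) {x : X}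
    {γ : Fin d → ℤ} : γ ∈ hA.cell hfree x ↔ SameCell A x (γ +ᵥ x) := by
  rw [IsToast.cell, Set.Finite.mem_toFinset]
  rfl

theorem IsToast.measurableSet_sameCell [MeasurableConstVAdd (Fin d → ℤ) X] (hA : IsToast d A)
    (α β : Fin d → ℤ) : MeasurableSet {x | SameCell A (α +ᵥ x) (β +ᵥ x)} := by
  have h : {x | SameCell A (α +ᵥ x) (β +ᵥ x)} = ⋂ n, ⋂ δ : Fin d → ℤ,
      {x | α +ᵥ x ∈ A n (δ +ᵥ x) ↔ β +ᵥ x ∈ A n (δ +ᵥ x)} := by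
    ext x
    simp only [SameCell, Set.mem_ofPred_eq, Set.mem_iInter]
    constructor
    · exact fun h n δ => h n _
    · intro h n m
      obtain ⟨R, hR⟩ := hA.near n
      constructor
      · intro hm
        obtain ⟨γ, -, hγ⟩ := (hR m _ hm).symm
        rw [← hγ, ← add_vadd] at hm ⊢
        exact (h n _).1 hm
      · intro hm
        obtain ⟨γ, -, hγ⟩ := (hR m _ hm).symm
        rw [← hγ, ← add_vadd] at hm ⊢
        exact (h n _).2 hm
  rw [h]
  refine MeasurableSet.iInter fun n => MeasurableSet.iInter fun δ => ?_
  have h1 := hA.measurableSet_mem n α δ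
  have h2 := hA.measurableSet_mem n β δ
  have : {x | α +ᵥ x ∈ A n (δ +ᵥ x) ↔ β +ᵥ x ∈ A n (δ +ᵥ x)} =
      ({x | α +ᵥ x ∈ A n (δ +ᵥ x)} ∩ {x | β +ᵥ x ∈ A n (δ +ᵥ x)}) ∪
      ({x | α +ᵥ x ∈ A n (δ +ᵥ x)}ᶜ ∩ {x | β +ᵥ x ∈ A n (δ +ᵥ x)}ᶜ) := by
    ext x
    exact iff_iff_and_or_not_and_not
  rw [this]
  exact (h1.inter h2).union (h1.compl.inter h2.compl)

open Classical in
/-- An integer matrix that rounds the restriction of `G` to the cell of `b`, in coordinates with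
respect to `b`. -/
structure IsCellRounding (A : ℕ → X → Set X) (G : X → X → ℝ) (b : X)
    (z : (Fin d → ℤ) × (Fin d → ℤ) →₀ ℤ) : Prop where
  antisymm : ∀ α β : Fin d → ℤ, SameCell A b (α +ᵥ b) → SameCell A b (β +ᵥ b) →
    z (α, β) = - z (β, α)
  close : ∀ α β : Fin d → ℤ, SameCell A b (α +ᵥ b) → SameCell A b (β +ᵥ b) →
    |G (α +ᵥ b) (β +ᵥ b) - z (α, β)| ≤ 1
  sum_eq : ∀ α : Fin d → ℤ, SameCell A b (α +ᵥ b) → ∑ γ ∈ box d 1,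
    (if SameCell A b ((γ + α) +ᵥ b) then G (α +ᵥ b) ((γ + α) +ᵥ b) - z (α, γ + α) else 0) = 0

theorem measurableSet_isCellRounding [MeasurableConstVAdd (Fin d → ℤ) X] (hA : IsToast d A)
    {G : X → X → ℝ} (hG : IsBorelFlow d G) (z : (Fin d → ℤ) × (Fin d → ℤ) →₀ ℤ) :
    MeasurableSet {b | IsCellRounding A G b z} := by
  classical
  have hcell : ∀ α : Fin d → ℤ, MeasurableSet {b | SameCell A b (α +ᵥ b)} := fun α => by
    simpa only [zero_vadd] using hA.measurableSet_sameCell 0 α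
  have himp : ∀ {s t : Set X}, MeasurableSet s → MeasurableSet t →
      MeasurableSet {b | b ∈ s → b ∈ t} := by
    intro s t hs ht
    have : {b | b ∈ s → b ∈ t} = sᶜ ∪ t := by
      ext b
      exact imp_iff_not_or
    rw [this]
    exact hs.compl.union ht
  have h : {b | IsCellRounding A G b z} =
      (⋂ α : Fin d → ℤ, ⋂ β : Fin d → ℤ, {b | SameCell A b (α +ᵥ b) → SameCell A b (β +ᵥ b) →
        z (α, β) = - z (β, α)}) ∩
      ((⋂ α : Fin d → ℤ, ⋂ β : Fin d → ℤ, {b | SameCell A b (α +ᵥ b) → SameCell A b (β +ᵥ b) →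
        |G (α +ᵥ b) (β +ᵥ b) - z (α, β)| ≤ 1}) ∩
      ⋂ α : Fin d → ℤ, {b | SameCell A b (α +ᵥ b) → ∑ γ ∈ box d 1,
        (if SameCell A b ((γ + α) +ᵥ b) then G (α +ᵥ b) ((γ + α) +ᵥ b) - z (α, γ + α) else 0)
          = 0}) := by
    ext b
    simp only [Set.mem_inter_iff, Set.mem_iInter, Set.mem_ofPred_eq]
    exact ⟨fun h => ⟨h.antisymm, h.close, h.sum_eq⟩, fun h => ⟨h.1, h.2.1, h.2.2⟩⟩
  rw [h]
  refine (MeasurableSet.iInter fun α => MeasurableSet.iInter fun β => ?_).inter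
    ((MeasurableSet.iInter fun α => MeasurableSet.iInter fun β => ?_).inter
    (MeasurableSet.iInter fun α => ?_))
  · exact himp (hcell α) (himp (hcell β) (MeasurableSet.const _))
  · refine himp (hcell α) (himp (hcell β) ?_)
    exact measurableSet_le (((hG.measurable_vadd α β).sub_const _).norm) measurable_const
  · refine himp (hcell α) ?_
    refine measurableSet_eq_fun (Finset.measurable_sum _ fun γ _ => ?_) measurable_const
    exact Measurable.ite (hcell (γ + α)) ((hG.measurable_vadd α (γ + α)).sub_const _)
      measurable_const

theorem exists_isCellRounding (hA : IsToast d A) (hfree : IsFreeAction d X)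
    {G : X → X → ℝ} (hG : IsBorelFlow d G)
    (hint : ∀ x y, ¬ SameCell A x y → G x y ∈ integers) (b : X) :
    ∃ z : (Fin d → ℤ) × (Fin d → ℤ) →₀ ℤ, IsCellRounding A G b z := by
  classical
  have hsum : ∀ α : Fin d → ℤ, ∀ h : (Fin d → ℤ) → ℝ, (∀ β, h β ≠ 0 → β - α ∈ box d 1) →
      ∑ γ ∈ box d 1, (if SameCell A b ((γ + α) +ᵥ b) then h (γ + α) else 0) =
        ∑ j : hA.cell hfree b, h j := by
    intro α h hh
    rw [Finset.univ_eq_attach, Finset.sum_attach (hA.cell hfree b) h]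
    refine Finset.sum_bij_ne_zero (fun γ _ _ => γ + α) ?_ ?_ ?_ ?_
    · intro γ _ hne
      rw [hA.mem_cell hfree]
      by_contra hc
      exact hne (if_neg hc)
    · intro γ _ _ γ' _ _ h
      exact add_right_cancel h
    · intro β hβ hne
      refine ⟨β - α, hh β hne, ?_, by simp⟩
      rw [sub_add_cancel, if_pos ((hA.mem_cell hfree).1 hβ)]
      exact hne
    · intro γ _ hne
      by_cases hc : SameCell A b ((γ + α) +ᵥ b)
      · exact if_pos hc
      · exact absurd (if_neg hc) hne
  have hsupp : ∀ α β : Fin d → ℤ, G (α +ᵥ b) (β +ᵥ b) ≠ 0 → β - α ∈ box d 1 := fun α β h =>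
    hfree.near_vadd_iff.1 (hG.near _ _ h)
  obtain ⟨z, hz1, hz2, hz3⟩ := exists_rounding
    (fun i j : hA.cell hfree b => G ((i : Fin d → ℤ) +ᵥ b) ((j : Fin d → ℤ) +ᵥ b))
    (fun i j => hG.antisymm _ _) (fun i => by
      rw [← hsum i (fun β => G ((i : Fin d → ℤ) +ᵥ b) (β +ᵥ b)) (hsupp i)]
      have h1 := hG.sum_mem ((i : Fin d → ℤ) +ᵥ b)
      rw [← sub_sub_cancel (∑ γ ∈ box d 1, G ((i : Fin d → ℤ) +ᵥ b) (γ +ᵥ (i : Fin d → ℤ) +ᵥ b))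
        (∑ γ ∈ box d 1, _)]
      refine integers.sub_mem h1 ?_
      rw [← Finset.sum_sub_distrib]
      refine integers.sum_mem fun γ _ => ?_
      rw [add_vadd]
      split_ifs with hc
      · rw [sub_self]
        exact integers.zero_mem
      · rw [sub_zero]
        refine hint _ _ fun h => hc (((hA.mem_cell hfree).1 i.2).trans h))
  let w : (Fin d → ℤ) × (Fin d → ℤ) → ℤ := fun p =>
    if h : p.1 ∈ hA.cell hfree b ∧ p.2 ∈ hA.cell hfree b then z ⟨p.1, h.1⟩ ⟨p.2, h.2⟩ else 0
  have hw : ∀ i j : hA.cell hfree b, w (i, j) = z i j := fun i j => by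
    simp only [w]
    rw [dif_pos ⟨i.2, j.2⟩]
  refine ⟨Finsupp.onFinset (hA.cell hfree b ×ˢ hA.cell hfree b) w ?_, ?_, ?_, ?_⟩
  · intro p hp
    rw [Finset.mem_product]
    by_contra h
    exact hp (dif_neg h)
  · intro α β hα hβ
    simp only [Finsupp.onFinset_apply]
    exact (hw ⟨α, (hA.mem_cell hfree).2 hα⟩ ⟨β, (hA.mem_cell hfree).2 hβ⟩).trans
      ((hz1 _ _).trans (congrArg Neg.neg (hw _ _).symm))
  · intro α β hα hβ
    simp only [Finsupp.onFinset_apply]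
    have h1 := hw ⟨α, (hA.mem_cell hfree).2 hα⟩ ⟨β, (hA.mem_cell hfree).2 hβ⟩
    have h2 := hz2 ⟨α, (hA.mem_cell hfree).2 hα⟩ ⟨β, (hA.mem_cell hfree).2 hβ⟩
    simp only at h1 h2
    rw [h1, abs_le]
    have h3 := Int.lt_floor_add_one (G (α +ᵥ b) (β +ᵥ b))
    have h4 := Int.ceil_lt_add_one (G (α +ᵥ b) (β +ᵥ b))
    have h5 : (⌊G (α +ᵥ b) (β +ᵥ b)⌋ : ℝ) ≤ _ := Int.cast_le.2 h2.1
    have h6 : (_ : ℝ) ≤ ⌈G (α +ᵥ b) (β +ᵥ b)⌉ := Int.cast_le.2 h2.2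
    constructor <;> linarith
  · intro α hα
    simp only [Finsupp.onFinset_apply]
    have h1 := hsum α (fun β => G (α +ᵥ b) (β +ᵥ b) - w (α, β)) (by
      intro β h
      by_contra hβ
      apply h
      have h2 : G (α +ᵥ b) (β +ᵥ b) = 0 := by
        by_contra h'
        exact hβ (hsupp α β h')
      have h3 : w (α, β) = 0 := by
        simp only [w]
        split_ifs with h'
        · have := hz2 ⟨α, h'.1⟩ ⟨β, h'.2⟩
          simp only [h2, Int.floor_zero, Int.ceil_zero] at this
          omega
        · rfl
      simp [h2, h3])
    rw [h1, Finset.sum_sub_distrib, sub_eq_zero, ← hz3 ⟨α, (hA.mem_cell hfree).2 hα⟩]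
    refine Finset.sum_congr rfl fun j _ => ?_
    rw [hw ⟨α, (hA.mem_cell hfree).2 hα⟩ j]

/-- `b` is the point of its cell with the least value of `u`. -/
def IsBase (d : ℕ) {X : Type*} [AddAction (Fin d → ℤ) X] (A : ℕ → X → Set X) (u : X → ℝ)
    (b : X) : Prop := ∀ γ : Fin d → ℤ, SameCell A b (γ +ᵥ b) → u b ≤ u (γ +ᵥ b)

theorem exists_isBase (hA : IsToast d A) (hfree : IsFreeAction d X) (u : X → ℝ) (x : X) :
    ∃ δ : Fin d → ℤ, SameCell A x (δ +ᵥ x) ∧ IsBase d A u (δ +ᵥ x) := by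
  obtain ⟨δ, hδ, hmin⟩ := (hA.cell hfree x).exists_min_image (fun γ => u (γ +ᵥ x))
    ⟨0, (hA.mem_cell hfree).2 (by rw [zero_vadd]; exact SameCell.refl x)⟩
  rw [hA.mem_cell hfree] at hδ
  refine ⟨δ, hδ, fun γ hγ => ?_⟩
  have := hδ.trans hγ
  rw [← add_vadd] at this ⊢
  exact hmin _ ((hA.mem_cell hfree).2 this)

theorem measurableSet_isBase [MeasurableConstVAdd (Fin d → ℤ) X] (hA : IsToast d A) {u : X → ℝ}
    (hu : Measurable u) : MeasurableSet {b | IsBase d A u b} := by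
  have h : {b | IsBase d A u b} = ⋂ γ : Fin d → ℤ,
      ({b | SameCell A b (γ +ᵥ b)}ᶜ ∪ {b | u b ≤ u (γ +ᵥ b)}) := by
    ext b
    simp only [IsBase, Set.mem_ofPred_eq, Set.mem_iInter, Set.mem_union, Set.mem_compl_iff]
    exact forall_congr' fun γ => imp_iff_not_or
  rw [h]
  refine MeasurableSet.iInter fun γ => MeasurableSet.union ?_ ?_
  · have := hA.measurableSet_sameCell 0 γ
    simp only [zero_vadd] at this
    exact this.compl
  · exact measurableSet_le hu (hu.comp (measurable_const_vadd γ))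

theorem IsBase.eq (hA : IsToast d A) {u : X → ℝ} (hu : Function.Injective u) {b b' : X}
    (hb : IsBase d A u b) (hb' : IsBase d A u b') (h : SameCell A b b') : b = b' := by
  apply hu
  apply le_antisymm
  · obtain ⟨γ, rfl⟩ := hA.exists_vadd_eq_of_sameCell h
    exact hb γ h
  · obtain ⟨γ, rfl⟩ := hA.exists_vadd_eq_of_sameCell h.symm
    exact hb' γ h.symm

open Classical in
/-- A Borel flow that is integral on the edges between different cells of a toast can be rounded to
an integral Borel flow. -/
theorem exists_integral_of_integral_between_cells [StandardBorelSpace X]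
    [MeasurableConstVAdd (Fin d → ℤ) X] (hA : IsToast d A) (hfree : IsFreeAction d X)
    {G : X → X → ℝ} (hG : IsBorelFlow d G)
    (hint : ∀ x y, ¬ SameCell A x y → G x y ∈ integers) :
    ∃ Ψ : X → X → ℝ, (∀ x y, Ψ x y = - Ψ y x) ∧ (∀ x y, Ψ x y ∈ integers) ∧
      (∀ γ : Fin d → ℤ, Measurable fun x => Ψ x (γ +ᵥ x)) ∧
      (∀ x, ∑ γ ∈ box d 1, Ψ x (γ +ᵥ x) = ∑ γ ∈ box d 1, G x (γ +ᵥ x)) ∧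
      ∀ x y, |G x y - Ψ x y| ≤ 1 := by
  obtain ⟨q, hq⟩ := exists_surjective_nat ((Fin d → ℤ) × (Fin d → ℤ) →₀ ℤ)
  have hu := MeasureTheory.measurableEmbedding_embeddingReal X
  set u := MeasureTheory.embeddingReal X
  have hex : ∀ b, ∃ k, IsCellRounding A G b (q k) := fun b => by
    obtain ⟨z, hz⟩ := exists_isCellRounding hA hfree hG hint b
    obtain ⟨k, rfl⟩ := hq z
    exact ⟨k, hz⟩
  let idx : X → ℕ := fun b => Nat.find (hex b)
  have hidx : ∀ b, IsCellRounding A G b (q (idx b)) := fun b => Nat.find_spec (hex b)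
  have hidxm : Measurable idx := measurable_find hex fun k =>
    measurableSet_isCellRounding hA hG (q k)
  choose δ hδ hbase using fun x => exists_isBase hA hfree u x
  let P : X → X → ℝ → Prop := fun x y r => ∃ b, ∃ α β : Fin d → ℤ, IsBase d A u b ∧
    SameCell A b x ∧ α +ᵥ b = x ∧ β +ᵥ b = y ∧ r = q (idx b) (α, β)
  have hPuniq : ∀ x y r r', P x y r → P x y r' → r = r' := by
    rintro x y r r' ⟨b, α, β, hb, hbx, hα, hβ, rfl⟩ ⟨b', α', β', hb', hbx', hα', hβ', rfl⟩
    have h := hb.eq hA hu.injective hb' (hbx.trans hbx'.symm)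
    subst h
    rw [hfree.vadd_injective b (hα.trans hα'.symm), hfree.vadd_injective b (hβ.trans hβ'.symm)]
  have hPex : ∀ x y, SameCell A x y → ∃ r, P x y r := by
    intro x y hxy
    obtain ⟨γ, rfl⟩ := hA.exists_vadd_eq_of_sameCell hxy
    exact ⟨_, δ x +ᵥ x, -δ x, γ - δ x, hbase x, (hδ x).symm, neg_vadd_vadd _ _, by
      rw [← add_vadd, sub_add_cancel], rfl⟩
  let Ψ : X → X → ℝ := fun x y => if h : SameCell A x y then (hPex x y h).choose else G x y
  have hΨ : ∀ x y r, SameCell A x y → P x y r → Ψ x y = r := by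
    intro x y r h hr
    simp only [Ψ]
    rw [dif_pos h]
    exact hPuniq x y _ _ (hPex x y h).choose_spec hr
  have hΨ' : ∀ x y, ¬ SameCell A x y → Ψ x y = G x y := fun x y h => dif_neg h
  refine ⟨Ψ, ?_, ?_, ?_, ?_, ?_⟩
  · intro x y
    by_cases h : SameCell A x y
    · obtain ⟨r, hr⟩ := hPex x y h
      obtain ⟨b, α, β, hb, hbx, rfl, rfl, rfl⟩ := id hr
      rw [hΨ _ _ _ h hr, hΨ _ _ _ h.symm ⟨b, β, α, hb, hbx.trans h, rfl, rfl, rfl⟩,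
        (hidx b).antisymm α β hbx (hbx.trans h)]
      push_cast
      ring
    · rw [hΨ' x y h, hΨ' y x fun h' => h h'.symm]
      exact hG.antisymm x y
  · intro x y
    by_cases h : SameCell A x y
    · obtain ⟨r, hr⟩ := hPex x y h
      rw [hΨ x y r h hr]
      obtain ⟨b, α, β, hb, hbx, -, -, rfl⟩ := hr
      exact intCast_mem_integers _
    · rw [hΨ' x y h]
      exact hint x y h
  · intro γ
    have hc : ∀ α : Fin d → ℤ, MeasurableSet {x | SameCell A x (α +ᵥ x)} := fun α => by
      simpa only [zero_vadd] using hA.measurableSet_sameCell 0 α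
    let s : Option ((Fin d → ℤ) × ℕ) → Set X := fun i =>
      i.elim {x | SameCell A x (γ +ᵥ x)}ᶜ fun p =>
        {x | SameCell A x (γ +ᵥ x)} ∩ ({x | SameCell A x (p.1 +ᵥ x)} ∩
          {x | p.1 +ᵥ x ∈ {b | IsBase d A u b} ∩ idx ⁻¹' {p.2}})
    let h : Option ((Fin d → ℤ) × ℕ) → X → ℝ := fun i =>
      i.elim (fun x => G x (γ +ᵥ x)) fun p _ => q p.2 (-p.1, γ - p.1)
    refine measurable_of_cover (s := s) (h := h) ?_ ?_ ?_ ?_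
    · rintro (_ | ⟨ε, k⟩)
      · exact (hc γ).compl
      · exact (hc γ).inter ((hc ε).inter (measurableSet_vadd
          ((measurableSet_isBase hA hu.measurable).inter (hidxm (measurableSet_singleton k))) ε))
    · rintro (_ | ⟨ε, k⟩)
      · exact hG.measurable γ
      · exact measurable_const
    · intro x
      by_cases hx : SameCell A x (γ +ᵥ x)
      · exact ⟨some (δ x, idx (δ x +ᵥ x)), hx, hδ x, hbase x, rfl⟩
      · exact ⟨none, hx⟩
    · rintro (_ | ⟨ε, k⟩) x hx
      · exact hΨ' _ _ hx
      · obtain ⟨h1, h2, h3, h4⟩ := hx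
        have h5 : idx (ε +ᵥ x) = k := h4
        exact hΨ _ _ _ h1 ⟨ε +ᵥ x, -ε, γ - ε, h3, SameCell.symm h2, neg_vadd_vadd _ _, by
          rw [← add_vadd, sub_add_cancel], by rw [h5]; rfl⟩
  · intro x
    obtain ⟨r, b, α, -, hb, hbx, rfl, -, -⟩ := hPex x x (SameCell.refl x)
    rw [eq_comm, ← sub_eq_zero, ← Finset.sum_sub_distrib, ← (hidx b).sum_eq α hbx]
    refine Finset.sum_congr rfl fun γ _ => ?_
    rw [add_vadd]
    split_ifs with h
    · rw [hΨ _ _ _ (hbx.symm.trans h) ⟨b, α, γ + α, hb, hbx, rfl, add_vadd _ _ _, rfl⟩]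
    · rw [hΨ' _ _ fun h' => h (hbx.trans h'), sub_self]
  · intro x y
    by_cases h : SameCell A x y
    · obtain ⟨r, hr⟩ := hPex x y h
      rw [hΨ x y r h hr]
      obtain ⟨b, α, β, hb, hbx, rfl, rfl, rfl⟩ := hr
      exact (hidx b).close α β hbx (hbx.trans h)
    · rw [hΨ' x y h, sub_self, abs_zero]
      exact zero_le_one

end Cells

section ActionGraph

variable {d : ℕ} {X : Type*} [AddAction (Fin d → ℤ) X]

theorem actionGraph_adj_vadd_iff (hfree : IsFreeAction d X) {x : X} {γ : Fin d → ℤ} :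
    (actionGraph d X).Adj x (γ +ᵥ x) ↔ γ ∈ box d 1 ∧ γ ≠ 0 := by
  constructor
  · rintro ⟨-, γ', hγ', h⟩
    rw [← hfree.vadd_injective x h]
    exact norm_eq_one_iff.1 hγ'
  · intro h
    exact ⟨fun h' => h.2 (hfree γ x h'.symm), γ, norm_eq_one_iff.2 h, rfl⟩

theorem near_of_adj {x y : X} (h : (actionGraph d X).Adj x y) : Near d 1 x y := by
  obtain ⟨-, γ, hγ, h⟩ := h
  exact ⟨γ, (norm_eq_one_iff.1 hγ).1, h⟩

theorem sum_neighborSet_eq (hfree : IsFreeAction d X) {F : X → X → ℝ}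
    (hF : ∀ x, F x x = 0) (x : X) :
    ∑ y : (actionGraph d X).neighborSet x, F x y = ∑ γ ∈ box d 1, F x (γ +ᵥ x) := by
  classical
  rw [← Finset.add_sum_erase _ _ (zero_mem_box zero_le_one), zero_vadd, hF, zero_add]
  symm
  refine Finset.sum_bij (fun γ hγ => ⟨γ +ᵥ x, (actionGraph_adj_vadd_iff hfree).2
    ⟨Finset.mem_of_mem_erase hγ, Finset.ne_of_mem_erase hγ⟩⟩) ?_ ?_ ?_ ?_
  · exact fun _ _ => Finset.mem_univ _
  · intro γ _ γ' _ h
    exact hfree.vadd_injective x (congrArg Subtype.val h)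
  · rintro ⟨y, hy⟩ _
    obtain ⟨γ, -, rfl⟩ := near_of_adj hy
    have := (actionGraph_adj_vadd_iff hfree).1 hy
    exact ⟨γ, Finset.mem_erase.2 ⟨this.2, this.1⟩, rfl⟩
  · exact fun _ _ => rfl

open Classical in
/-- The extension by zero of a function on the oriented edges. -/
noncomputable def extendDart (φ : (actionGraph d X).Dart → ℝ) (x y : X) : ℝ :=
  if h : (actionGraph d X).Adj x y then φ ⟨(x, y), h⟩ else 0

theorem extendDart_apply (φ : (actionGraph d X).Dart → ℝ) (e : (actionGraph d X).Dart) :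
    extendDart φ e.fst e.snd = φ e := dif_pos e.adj

theorem extendDart_of_not_adj (φ : (actionGraph d X).Dart → ℝ) {x y : X}
    (h : ¬ (actionGraph d X).Adj x y) : extendDart φ x y = 0 := dif_neg h

theorem sum_extendDart (hfree : IsFreeAction d X) (φ : (actionGraph d X).Dart → ℝ) (x : X) :
    ∑ γ ∈ box d 1, extendDart φ x (γ +ᵥ x) =
      ∑ y : (actionGraph d X).neighborSet x, φ ((actionGraph d X).dartOfNeighborSet x y) := by
  rw [← sum_neighborSet_eq hfree fun x =>
    extendDart_of_not_adj φ (SimpleGraph.irrefl (actionGraph d X) (v := x))]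
  exact Finset.sum_congr rfl fun y _ =>
    extendDart_apply φ ((actionGraph d X).dartOfNeighborSet x y)

variable [MeasurableSpace X]

theorem measurable_dart_fst (G : SimpleGraph X) : Measurable fun e : G.Dart => e.fst :=
  measurable_fst.comp (comap_measurable fun e : G.Dart => e.toProd)

theorem measurable_dart_snd (G : SimpleGraph X) : Measurable fun e : G.Dart => e.snd :=
  measurable_snd.comp (comap_measurable fun e : G.Dart => e.toProd)

variable [MeasurableConstVAdd (Fin d → ℤ) X]

theorem measurable_extendDart (hfree : IsFreeAction d X) {φ : (actionGraph d X).Dart → ℝ}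
    (hφ : Measurable φ) (γ : Fin d → ℤ) : Measurable fun x => extendDart φ x (γ +ᵥ x) := by
  by_cases hγ : γ ∈ box d 1 ∧ γ ≠ 0
  · have hadj : ∀ x : X, (actionGraph d X).Adj x (γ +ᵥ x) := fun x =>
      (actionGraph_adj_vadd_iff hfree).2 hγ
    have h1 : Measurable fun x : X => (⟨(x, γ +ᵥ x), hadj x⟩ : (actionGraph d X).Dart) :=
      measurable_comap_iff.2 (measurable_id.prodMk (measurable_const_vadd γ))
    have h2 : (fun x => extendDart φ x (γ +ᵥ x)) = fun x => φ ⟨(x, γ +ᵥ x), hadj x⟩ :=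
      funext fun x => dif_pos (hadj x)
    rw [h2]
    exact hφ.comp h1
  · have h : (fun x => extendDart φ x (γ +ᵥ x)) = fun _ => 0 := funext fun x =>
      extendDart_of_not_adj φ fun h => hγ ((actionGraph_adj_vadd_iff hfree).1 h)
    rw [h]
    exact measurable_const

theorem isBorelFlow_extendDart (hfree : IsFreeAction d X) {f : X → ℤ}
    {φ : (actionGraph d X).Dart → ℝ} (hφ : Measurable φ)
    (hflow : IsFlow (actionGraph d X) (fun x => (f x : ℝ)) φ) :
    IsBorelFlow d (extendDart φ) where
  antisymm x y := by
    by_cases h : (actionGraph d X).Adj x y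
    · have h1 := extendDart_apply φ ⟨(x, y), h⟩
      have h2 := extendDart_apply φ (SimpleGraph.Dart.symm ⟨(x, y), h⟩)
      have h3 := hflow.antisymm ⟨(x, y), h⟩
      simp only [SimpleGraph.Dart.symm_mk, Prod.swap_prod_mk] at h1 h2 h3
      rw [h1, h2, h3]
    · rw [extendDart_of_not_adj φ h, extendDart_of_not_adj φ fun h' => h h'.symm, neg_zero]
  near x y h := by
    by_contra hxy
    exact h (extendDart_of_not_adj φ fun h' => hxy (near_of_adj h'))
  measurable γ := measurable_extendDart hfree hφ γ
  sum_mem x := by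
    rw [sum_extendDart hfree, ← hflow.sum_eq]
    exact intCast_mem_integers _

theorem measurable_restrict_dart [StandardBorelSpace X] {Ψ : X → X → ℝ}
    (hΨ : ∀ γ : Fin d → ℤ, Measurable fun x => Ψ x (γ +ᵥ x)) :
    Measurable fun e : (actionGraph d X).Dart => Ψ e.fst e.snd := by
  refine measurable_of_cover
    (s := fun γ : Fin d → ℤ => {e : (actionGraph d X).Dart | γ +ᵥ e.fst = e.snd})
    (h := fun γ e => Ψ e.fst (γ +ᵥ e.fst)) ?_ ?_ ?_ ?_
  · exact fun γ => measurableSet_eq_fun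
      ((measurable_const_vadd γ).comp (measurable_dart_fst _)) (measurable_dart_snd _)
  · exact fun γ => (hΨ γ).comp (measurable_dart_fst _)
  · intro e
    obtain ⟨γ, -, h⟩ := near_of_adj e.adj
    exact ⟨γ, h⟩
  · intro γ e he
    have : γ +ᵥ e.fst = e.snd := he
    rw [this]

end ActionGraph

end BorelFlow

theorem lemma5p3 {d : ℕ} (hd : 2 ≤ d) {X : Type*} [MeasurableSpace X] [StandardBorelSpace X]
    [AddAction (Fin d → ℤ) X] [MeasurableConstVAdd (Fin d → ℤ) X]
    (hfree : BorelFlow.IsFreeAction d X)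
    (f : X → ℤ) (hf : Measurable f)
    (φ : (BorelFlow.actionGraph d X).Dart → ℝ) (hφ : Measurable φ)
    (hflow : BorelFlow.IsFlow (BorelFlow.actionGraph d X) (fun x => (f x : ℝ)) φ) :
    ∃ ψ : (BorelFlow.actionGraph d X).Dart → ℝ,
      Measurable ψ ∧
      BorelFlow.IsFlow (BorelFlow.actionGraph d X) (fun x => (f x : ℝ)) ψ ∧
      BorelFlow.IsIntegral (BorelFlow.actionGraph d X) ψ ∧
      ∀ e : (BorelFlow.actionGraph d X).Dart, |φ e - ψ e| ≤ 3 ^ d := by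
  open BorelFlow in
  have hF := isBorelFlow_extendDart hfree hφ hflow
  obtain ⟨A, hA⟩ := exists_toast hfree
  obtain ⟨G, hG, hGsum, hGclose, hGint⟩ := exists_integral_on_boundaries hd hA hfree hF
  obtain ⟨Ψ, hanti, hint, hmeas, hsum, hclose⟩ :=
    exists_integral_of_integral_between_cells hA hfree hG (by
      intro x y hxy
      simp only [SameCell, not_forall] at hxy
      obtain ⟨n, m, h⟩ := hxy
      by_cases hx : x ∈ A n m
      · exact hGint n m x y hx fun hy => h (iff_of_true hx hy)
      · have hy : y ∈ A n m := by
          by_contra hy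
          exact h (iff_of_false hx hy)
        rw [hG.antisymm]
        exact integers.neg_mem (hGint n m y x hy hx))
  refine ⟨fun e => Ψ e.fst e.snd, measurable_restrict_dart hmeas, ⟨?_, ?_⟩, ?_, ?_⟩
  · exact fun e => hanti _ _
  · intro x
    have hdiag : ∀ x, Ψ x x = 0 := fun x => by linarith [hanti x x]
    rw [hflow.sum_eq x, ← sum_extendDart hfree, ← hGsum, ← hsum, ← sum_neighborSet_eq hfree hdiag]
    rfl
  · exact fun e => mem_integers.1 (hint _ _)
  · intro e
    rw [← extendDart_apply φ e]
    have h1 := hGclose e.fst e.snd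
    have h2 := hclose e.fst e.snd
    have h3 := abs_sub_le (extendDart φ e.fst e.snd) (G e.fst e.snd) (Ψ e.fst e.snd)
    linarith
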